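/- Let $n,d,k\ge 1$ be fixed integers with $2\le d\le nk$. Let $V:\mathbb C^d\to\mathbb C^n\otimes\mathbb C^k$ be a Haar-distributed random isometry, i.e. its law is the unique probability measure on $\{V : V^*V=I_d\}$ that is invariant under left and right multiplication by unitary matrices. Write $V=\sum_{i=1}^k A_i\otimes e_i$ with $A_i\in M_{n\times d}(\mathbb C)$ and $\{e_i\}$ the standard basis of $\mathbb C^k$, let $\Phi(X)=[\mathrm{id}_n\otimes\mathrm{Tr}_k](VXV^*)=\sum_{i=1}^k A_iXA_i^*$ be the random quantum channel $M_d(\mathbb C)\to M_n(\mathbb C)$ induced by $V$, and let $$F=\sum_{i=1}^k A_i\otimes\overline{A_i}\in M_{n^2\times d^2}(\mathbb C)$$ be its super-operator (the matrix of $\Phi$ as a linear map $\mathbb C^{d^2}\to\mathbb C^{n^2}$). Let $\omega_d=\Omega_d\Omega_d^*$, where $\Omega_d=d^{-1/2}\sum_{i=1}^d e_i\otimes e_i$. A random matrix is Ginibre with parameters $(M,N;\sigma^2)$, written $\mathrm{Gin}(M,N;\sigma^2)$, if it is $M\times N$ with i.i.d. centered complex Gaussian entries of variance $\sigma^2$ (real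 and imaginary parts independent, each of variance $\sigma^2/2$). Let $\|\cdot\|_q$ denote the Schatten $q$-norm (the $\ell^q$ norm of the singular values; the operator norm for $q=\infty$), and put $$\chi_{M,N}=\frac{\mathbb E\|Y\|_1^2-1}{N^2-1},\qquad Y\sim\mathrm{Gin}(M,N;1/M).$$ Let $Y_1,\dots,Y_k,Z_1,\dots,Z_k$ be independent Ginibre random matrices of parameters $(n,d;(nk)^{-1})$. Then, for every real $p\ge 1$ and every $1\le q\le\infty$, both expectations below are finite and $$\mathbb E\left\|F(I_{d^2}-\omega_d)\right\|_q^p\le\left(\frac{2}{\chi_{nk,d}}\right)^p\,\mathbb E\left\|\sum_{i=1}^k Y_i\otimes Z_i\right\|_q^p .$$ -/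

import Mathlib

open MeasureTheory ProbabilityTheory Matrix
open scoped ENNReal NNReal Kronecker ComplexConjugate

/-- Matrices carry the product σ-algebra of their entries. -/
instance instMeasurableSpaceMatrixEntries {m n α : Type*} [MeasurableSpace α] :
    MeasurableSpace (Matrix m n α) :=
  inferInstanceAs (MeasurableSpace (m → n → α))

noncomputable section

/-- The singular values of a complex matrix, in decreasing order, padded by zeros. -/
def matrixSingularValue {m n : Type*} [Fintype m] [Fintype n] [DecidableEq n]
    (A : Matrix m n ℂ) (i : ℕ) : ℝ :=
  (Matrix.toEuclideanLin A).singularValues i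

/-- The Schatten `q`-norm `‖A‖_q`: the `ℓ^q` norm of the singular values of `A`
(for `q = ∞` the largest singular value, i.e. the operator norm). -/
def schattenNorm {m n : Type*} [Fintype m] [Fintype n] [DecidableEq n]
    (q : ℝ≥0∞) (A : Matrix m n ℂ) : ℝ :=
  if q = ∞ then matrixSingularValue A 0
  else (∑ i ∈ Finset.range (Fintype.card n), matrixSingularValue A i ^ q.toReal) ^ (1 / q.toReal)

/-- The centered complex Gaussian distribution of variance `v`: the real and imaginary parts are
independent real Gaussians of mean `0` and variance `v / 2`. -/
def complexGaussian (v : ℝ≥0) : Measure ℂ :=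
  ((gaussianReal 0 (v / 2)).prod (gaussianReal 0 (v / 2))).map (fun z : ℝ × ℝ => (⟨z.1, z.2⟩ : ℂ))

/-- The Ginibre distribution with parameters `(M, N; v)`: the law of an `M × N` random matrix with
i.i.d. centered complex Gaussian entries of variance `v`. -/
def ginibre (M N : ℕ) (v : ℝ≥0) : Measure (Matrix (Fin M) (Fin N) ℂ) :=
  Measure.pi (fun _ : Fin M => Measure.pi (fun _ : Fin N => complexGaussian v))

/-- The constant `χ_{M,N} = (𝔼 ‖Y‖₁² - 1) / (N² - 1)`, where `Y ∈ Gin(M, N; 1/M)` and `‖·‖₁` is the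
trace norm. -/
def chi (M N : ℕ) : ℝ :=
  ((∫ Y, schattenNorm 1 Y ^ 2 ∂(ginibre M N (M : ℝ≥0)⁻¹)) - 1) / ((N : ℝ) ^ 2 - 1)

/-- The Haar measure on the isometries `ℂ^d → ℂ^n ⊗ ℂ^k`: the probability measure concentrated on
`{V | Vᴴ V = 1}` which is invariant under left and right multiplication by unitary matrices. -/
structure IsHaarIsometryLaw {n k d : ℕ} (ν : Measure (Matrix (Fin n × Fin k) (Fin d) ℂ)) :
    Prop where
  isProbabilityMeasure : IsProbabilityMeasure ν
  isometry : ∀ᵐ V ∂ν, Vᴴ * V = 1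
  map_mul_left : ∀ U ∈ Matrix.unitaryGroup (Fin n × Fin k) ℂ, ν.map (fun V => U * V) = ν
  map_mul_right : ∀ U ∈ Matrix.unitaryGroup (Fin d) ℂ, ν.map (fun V => V * U) = ν

/-- The map `Φ(X) = [id_n ⊗ Tr_k](V X V^*)`; it is a quantum channel when `V` is an isometry. -/
def channel {n k d : ℕ} (V : Matrix (Fin n × Fin k) (Fin d) ℂ) (X : Matrix (Fin d) (Fin d) ℂ) :
    Matrix (Fin n) (Fin n) ℂ :=
  Matrix.of fun a b => ∑ i : Fin k, (V * X * Vᴴ) (a, i) (b, i)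

/-- The Kraus operators of the channel: the blocks `A_i` of `V = ∑ i, A_i ⊗ e_i`. -/
def krausOp {n k d : ℕ} (V : Matrix (Fin n × Fin k) (Fin d) ℂ) (i : Fin k) :
    Matrix (Fin n) (Fin d) ℂ :=
  Matrix.of fun a b => V (a, i) b

/-- The super-operator `F = ∑ i, A_i ⊗ conj A_i` of the channel defined by `V`. -/
def superOp {n k d : ℕ} (V : Matrix (Fin n × Fin k) (Fin d) ℂ) :
    Matrix (Fin n × Fin n) (Fin d × Fin d) ℂ :=
  ∑ i : Fin k, krausOp V i ⊗ₖ (krausOp V i).map conj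

/-- The super-operator is the matrix of the channel, seen as a linear map `ℂ^{d²} → ℂ^{n²}`. -/
theorem superOp_mulVec {n k d : ℕ} (V : Matrix (Fin n × Fin k) (Fin d) ℂ)
    (X : Matrix (Fin d) (Fin d) ℂ) :
    superOp V *ᵥ (fun x => X x.1 x.2) = fun y => channel V X y.1 y.2 := by
  funext y
  obtain ⟨a, b⟩ := y
  simp only [superOp, channel, krausOp, Matrix.mulVec, dotProduct, Matrix.sum_apply,
    Matrix.of_apply, Matrix.mul_apply, Matrix.kroneckerMap_apply, Matrix.map_apply,
    Matrix.conjTranspose_apply, Fintype.sum_prod_type, Finset.sum_mul]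
  rw [Finset.sum_congr rfl fun x _ => Finset.sum_comm, Finset.sum_comm]
  refine Finset.sum_congr rfl fun i _ => ?_
  rw [Finset.sum_comm]
  refine Finset.sum_congr rfl fun x _ => Finset.sum_congr rfl fun y _ => ?_
  simp only [starRingEnd_apply]
  ring

/-- The maximally entangled vector `Ω_d = d^{-1/2} ∑ i, e_i ⊗ e_i`. -/
def maxEntVec (d : ℕ) : Fin d × Fin d → ℂ :=
  fun x => if x.1 = x.2 then ((1 / Real.sqrt d : ℝ) : ℂ) else 0

/-- The maximally entangled state `ω_d = Ω_d Ω_d^*`. -/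
def maxEnt (d : ℕ) : Matrix (Fin d × Fin d) (Fin d × Fin d) ℂ :=
  Matrix.vecMulVec (maxEntVec d) (star (maxEntVec d))

end

/-!
The argument compares the Haar isometry with a Ginibre matrix through the polar decomposition and
then decouples the resulting quadratic Gaussian form.

*From the isometry to a Gaussian matrix.* If `G` is an `nk × d` Ginibre matrix of variance
`(nk)⁻¹` independent of the Haar isometry `V`, then `V |G|` has the law of `G`
(`map_isometry_mul_matrixAbs`), and `F(V H) = F(V) (H ⊗ conj H)`. The matrix
`T = 𝔼 |G| ⊗ conj |G|` commutes with every `U ⊗ conj U`, `U` unitary, because the law of `G` is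
invariant under right multiplication by `U`. Hence `T` is a combination of the identity and of
`ω_d` (`eq_of_commute_unitary_kronecker_conj`); the two coefficients are determined by the sums of
the entries `T (a, b) (a, b)` and `T (a, a) (c, c)`, which are `𝔼 ‖G‖₁²` and `𝔼 ‖G‖₂² = d`. This
gives `T (1 - ω_d) = χ (1 - ω_d)` (`absMoment_mul_one_sub_maxEnt`). So `χ F(V) (1 - ω_d)` is the
conditional expectation of `F(V |G|) (1 - ω_d)` given `V`, and Jensen's inequality bounds its `L^p`
norm by that of `F(G) (1 - ω_d)` (`eLpNorm_superOp_isometry_le`).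

*Decoupling.* The expectation of `F(G)` is annihilated by `1 - ω_d` on the right. Subtracting an
independent copy and using Jensen again, the `L^p` norm of `F(G) (1 - ω_d)` is at most that of
`F(G) - F(G')`, the projection `1 - ω_d` being dropped since it is a contraction. The pair
`((G + G') / √2, (G - G') / √2)` has the same law as `(G, G')`, which turns the difference into
`∑ i, G_i ⊗ conj G'_i + ∑ i, G'_i ⊗ conj G_i`. The two sums have the same law up to exchanging
`G` and `G'`, whence the factor `2` (`eLpNorm_superOp_gaussianMatrix_le`). Finally `conj G'` has the
law of `G'`.

Dividing by `χ` is legitimate since `‖G‖₁² ≥ ‖G‖₂²` gives `𝔼 ‖G‖₁² ≥ d > 1` (`chi_pos`). The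
triangle inequality for the Schatten norms, on which the use of Jensen's inequality rests, comes
from a variational formula: `‖A‖_q` is the largest `ℓ^q` norm of `(⟪u i, A w i⟫)` over Bessel
families `u`, `w` (`norm_toLp_inner_le_schattenNorm`, `exists_schattenNorm_eq`).
-/

noncomputable section

/-! ### Schatten norms -/

/-- A finite family satisfying Bessel's inequality, i.e. with contractive analysis operator. In
contrast to orthonormality this allows zero vectors and survives orthogonal projection. -/
def IsBessel {E ι : Type*} [NormedAddCommGroup E] [InnerProductSpace ℂ E] [Fintype ι]
    (u : ι → E) : Prop :=
  ∀ x, ∑ i, ‖inner ℂ (u i) x‖ ^ 2 ≤ ‖x‖ ^ 2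

theorem IsBessel.norm_le_one {E ι : Type*} [NormedAddCommGroup E] [InnerProductSpace ℂ E]
    [Fintype ι] {u : ι → E} (hu : IsBessel u) (i : ι) : ‖u i‖ ≤ 1 := by
  have h1 : ‖inner ℂ (u i) (u i)‖ ^ 2 ≤ ‖u i‖ ^ 2 :=
    (Finset.single_le_sum (f := fun j => ‖inner ℂ (u j) (u i)‖ ^ 2) (fun j _ => by positivity)
      (Finset.mem_univ i)).trans (hu (u i))
  rw [inner_self_eq_norm_sq_to_K] at h1
  simp only [norm_pow, Complex.coe_algebraMap, Complex.norm_real, norm_norm] at h1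
  by_contra! h
  have h2 : 1 < ‖u i‖ ^ 2 := one_lt_pow₀ h two_ne_zero
  nlinarith

theorem Orthonormal.isBessel {E ι : Type*} [NormedAddCommGroup E] [InnerProductSpace ℂ E]
    [Fintype ι] {u : ι → E} (hu : Orthonormal ℂ u) : IsBessel u :=
  fun x => hu.sum_inner_products_le x (s := Finset.univ)

/-- Doubly substochastic arrays do not increase power sums: weighted power means in each row, then
summation over the columns. -/
theorem substochastic_rpow_sum_le {ι κ : Type*} [Fintype ι] [Fintype κ] {p : ι → κ → ℝ}
    (hp : ∀ i j, 0 ≤ p i j) (hrow : ∀ i, ∑ j, p i j ≤ 1) (hcol : ∀ j, ∑ i, p i j ≤ 1)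
    {x : κ → ℝ} (hx : ∀ j, 0 ≤ x j) {r : ℝ} (hr : 1 ≤ r) :
    ∑ i, (∑ j, p i j * x j) ^ r ≤ ∑ j, x j ^ r := by
  have h1 : ∀ i, (∑ j, p i j * x j) ^ r ≤ ∑ j, p i j * x j ^ r := by
    intro i
    have h0 : 0 ≤ ∑ j, p i j * x j ^ r :=
      Finset.sum_nonneg fun j _ => mul_nonneg (hp i j) (Real.rpow_nonneg (hx j) r)
    have h := Real.inner_le_weight_mul_Lp_of_nonneg Finset.univ hr (p i) x (hp i) hx
    have h2 : ∑ j, p i j * x j ≤ (∑ j, p i j * x j ^ r) ^ r⁻¹ := by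
      refine h.trans (mul_le_of_le_one_left (Real.rpow_nonneg h0 _) ?_)
      exact Real.rpow_le_one (Finset.sum_nonneg fun j _ => hp i j) (hrow i)
        (by have := inv_le_one_of_one_le₀ hr; linarith)
    calc (∑ j, p i j * x j) ^ r ≤ ((∑ j, p i j * x j ^ r) ^ r⁻¹) ^ r :=
          Real.rpow_le_rpow (Finset.sum_nonneg fun j _ => mul_nonneg (hp i j) (hx j)) h2
            (by linarith)
      _ = _ := by rw [← Real.rpow_mul h0, inv_mul_cancel₀ (by linarith), Real.rpow_one]
  calc _ ≤ ∑ i, ∑ j, p i j * x j ^ r := Finset.sum_le_sum fun i _ => h1 i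
    _ = ∑ j, (∑ i, p i j) * x j ^ r := by rw [Finset.sum_comm]; simp_rw [Finset.sum_mul]
    _ ≤ _ := Finset.sum_le_sum fun j _ =>
      mul_le_of_le_one_left (Real.rpow_nonneg (hx j) r) (hcol j)

section SVD

variable {m n : Type*} [Fintype m] [Fintype n] [DecidableEq n]

/-- Singular value decomposition. The left singular vectors are set to zero where the singular value
vanishes, so they form a Bessel family rather than an orthonormal one. -/
theorem exists_svd (A : Matrix m n ℂ) :
    ∃ (e : OrthonormalBasis (Fin (Fintype.card n)) ℂ (EuclideanSpace ℂ n))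
      (f : Fin (Fintype.card n) → EuclideanSpace ℂ m), IsBessel f ∧
      (∀ j, Matrix.toEuclideanLin A (e j) = (matrixSingularValue A j : ℂ) • f j) ∧
      (∀ j, inner ℂ (f j) (Matrix.toEuclideanLin A (e j)) = (matrixSingularValue A j : ℂ)) := by
  set T := Matrix.toEuclideanLin A with hT
  have hn : Module.finrank ℂ (EuclideanSpace ℂ n) = Fintype.card n := finrank_euclideanSpace
  set e := T.isSymmetric_adjoint_comp_self.eigenvectorBasis hn with he
  set s : Fin (Fintype.card n) → ℝ := fun j => matrixSingularValue A j with hs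
  have hinner : ∀ i j, inner ℂ (T (e i)) (T (e j)) = if i = j then ((s j : ℂ)) ^ 2 else 0 := by
    intro i j
    rw [← LinearMap.adjoint_inner_right, ← LinearMap.comp_apply,
      LinearMap.IsSymmetric.apply_eigenvectorBasis, inner_smul_right,
      orthonormal_iff_ite.1 e.orthonormal i j, ← T.sq_singularValues_fin hn]
    split_ifs <;> simp [hs, matrixSingularValue, hT]
  have hzero : ∀ j, s j = 0 → T (e j) = 0 := by
    intro j hj
    have := hinner j j
    rw [if_pos rfl, hj] at this
    simpa using this
  refine ⟨e, fun j => ((s j : ℂ)⁻¹) • T (e j), ?_, ?_, ?_⟩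
  · intro x
    set S : Finset (Fin (Fintype.card n)) := Finset.univ.filter fun j => s j ≠ 0 with hS
    have hsub : ∑ i, ‖inner ℂ (((s i : ℂ)⁻¹) • T (e i)) x‖ ^ 2 =
        ∑ i : {j // s j ≠ 0}, ‖inner ℂ (((s i : ℂ)⁻¹) • T (e i)) x‖ ^ 2 := by
      rw [← Finset.sum_subtype (s := S) (p := fun j => s j ≠ 0) (by simp [hS])
        (fun i => ‖inner ℂ (((s i : ℂ)⁻¹) • T (e i)) x‖ ^ 2)]
      refine (Finset.sum_subset (Finset.subset_univ _) fun i _ hi => ?_).symm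
      have : s i = 0 := by simpa [hS] using hi
      simp [this]
    rw [hsub]
    have ho : Orthonormal ℂ fun i : {j // s j ≠ 0} => ((s i : ℂ)⁻¹) • T (e i) := by
      rw [orthonormal_iff_ite]
      intro i j
      have hi : (s i : ℂ) ≠ 0 := by exact_mod_cast i.2
      rw [inner_smul_left, inner_smul_right, hinner]
      by_cases hij : i = j
      · subst hij
        simp only [map_inv₀, Complex.conj_ofReal, if_true]
        field_simp
      · have : (i : Fin (Fintype.card n)) ≠ (j : Fin (Fintype.card n)) := fun h' =>
          hij (Subtype.ext h')
        simp [hij, this]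
    exact ho.sum_inner_products_le x (s := Finset.univ)
  · intro j
    by_cases hj : s j = 0
    · have h2 : matrixSingularValue A j = 0 := hj
      rw [hzero j hj, h2]; simp
    · have : (s j : ℂ) ≠ 0 := by exact_mod_cast hj
      change _ = (s j : ℂ) • ((s j : ℂ)⁻¹ • T (e j))
      rw [smul_smul, mul_inv_cancel₀ this, one_smul]
  · intro j
    rw [inner_smul_left, hinner, if_pos rfl]
    change _ = (s j : ℂ)
    by_cases hj : s j = 0
    · simp [hj]
    · have : (s j : ℂ) ≠ 0 := by exact_mod_cast hj
      simp only [map_inv₀, Complex.conj_ofReal]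
      field_simp

theorem matrixSingularValue_nonneg (A : Matrix m n ℂ) (i : ℕ) : 0 ≤ matrixSingularValue A i :=
  LinearMap.singularValues_nonneg _ i

/-- The vector of singular values, as an element of `ℓ^q`. -/
def singularVector (q : ℝ≥0∞) (A : Matrix m n ℂ) :
    PiLp q (fun _ : Fin (Fintype.card n) => ℝ) :=
  WithLp.toLp q fun j => matrixSingularValue A j

theorem schattenNorm_eq_norm (q : ℝ≥0∞) [Fact (1 ≤ q)] (A : Matrix m n ℂ) :
    schattenNorm q A = ‖singularVector q A‖ := by
  unfold schattenNorm singularVector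
  have hq : 1 ≤ q := Fact.out
  split_ifs with h
  · subst h
    rw [PiLp.norm_eq_ciSup]
    simp only [Real.norm_of_nonneg (matrixSingularValue_nonneg A _)]
    rcases Nat.eq_zero_or_pos (Fintype.card n) with h0 | h0
    · have : IsEmpty (Fin (Fintype.card n)) := by rw [h0]; infer_instance
      rw [Real.iSup_of_isEmpty]
      exact LinearMap.singularValues_of_finrank_le _ (by rw [finrank_euclideanSpace, h0])
    · have : Nonempty (Fin (Fintype.card n)) := ⟨⟨0, h0⟩⟩
      refine le_antisymm (le_ciSup (f := fun i : Fin (Fintype.card n) =>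
        matrixSingularValue A i) (Set.finite_range _).bddAbove ⟨0, h0⟩) (ciSup_le fun i => ?_)
      exact LinearMap.singularValues_antitone _ (Nat.zero_le _)
  · have hq0 : 0 < q.toReal := ENNReal.toReal_pos (by positivity) h
    rw [PiLp.norm_eq_sum hq0]
    simp only [Real.norm_of_nonneg (matrixSingularValue_nonneg A _)]
    rw [Finset.sum_range]

theorem norm_toLp_mono (q : ℝ≥0∞) [Fact (1 ≤ q)] {ι : Type*} [Fintype ι] {x y : ι → ℝ}
    (hx : ∀ i, 0 ≤ x i) (hxy : ∀ i, x i ≤ y i) :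
    ‖(WithLp.toLp q x : PiLp q fun _ : ι => ℝ)‖ ≤ ‖(WithLp.toLp q y : PiLp q fun _ : ι => ℝ)‖ := by
  have hq : 1 ≤ q := Fact.out
  have hy : ∀ i, 0 ≤ y i := fun i => (hx i).trans (hxy i)
  by_cases h : q = ∞
  · subst h
    rw [PiLp.norm_eq_ciSup, PiLp.norm_eq_ciSup]
    simp only [Real.norm_of_nonneg (hx _), Real.norm_of_nonneg (hy _)]
    exact ciSup_mono (Set.finite_range _).bddAbove hxy
  · have hq0 : 0 < q.toReal := ENNReal.toReal_pos (by positivity) h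
    rw [PiLp.norm_eq_sum hq0, PiLp.norm_eq_sum hq0]
    simp only [Real.norm_of_nonneg (hx _), Real.norm_of_nonneg (hy _)]
    gcongr
    · exact Finset.sum_nonneg fun i _ => Real.rpow_nonneg (hx i) _
    · exact hx _
    · exact hxy _

theorem norm_toLp_substochastic_le (q : ℝ≥0∞) [Fact (1 ≤ q)] {ι κ : Type*} [Fintype ι] [Fintype κ]
    {p : ι → κ → ℝ} (hp : ∀ i j, 0 ≤ p i j) (hrow : ∀ i, ∑ j, p i j ≤ 1)
    (hcol : ∀ j, ∑ i, p i j ≤ 1) {x : κ → ℝ} (hx : ∀ j, 0 ≤ x j) :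
    ‖(WithLp.toLp q fun i => ∑ j, p i j * x j : PiLp q fun _ : ι => ℝ)‖ ≤
      ‖(WithLp.toLp q x : PiLp q fun _ : κ => ℝ)‖ := by
  have hq : 1 ≤ q := Fact.out
  have hpx : ∀ i, 0 ≤ ∑ j, p i j * x j := fun i =>
    Finset.sum_nonneg fun j _ => mul_nonneg (hp i j) (hx j)
  by_cases h : q = ∞
  · subst h
    rw [PiLp.norm_eq_ciSup, PiLp.norm_eq_ciSup]
    simp only [Real.norm_of_nonneg (hx _), Real.norm_of_nonneg (hpx _)]
    have hs : 0 ≤ ⨆ j, x j := Real.iSup_nonneg hx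
    refine Real.iSup_le (fun i => ?_) hs
    calc ∑ j, p i j * x j ≤ ∑ j, p i j * ⨆ j, x j := Finset.sum_le_sum fun j _ =>
          mul_le_mul_of_nonneg_left (le_ciSup (Set.finite_range x).bddAbove j) (hp i j)
      _ = (∑ j, p i j) * ⨆ j, x j := by rw [Finset.sum_mul]
      _ ≤ _ := mul_le_of_le_one_left hs (hrow i)
  · have hq0 : 0 < q.toReal := ENNReal.toReal_pos (by positivity) h
    have hq1 : 1 ≤ q.toReal := by
      rw [← ENNReal.toReal_one]; exact ENNReal.toReal_mono h hq
    rw [PiLp.norm_eq_sum hq0, PiLp.norm_eq_sum hq0]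
    simp only [Real.norm_of_nonneg (hx _), Real.norm_of_nonneg (hpx _)]
    gcongr
    · exact Finset.sum_nonneg fun i _ => Real.rpow_nonneg (hpx i) _
    · exact substochastic_rpow_sum_le hp hrow hcol hx hq1

/-- The upper bound in the variational formula for the Schatten norm. Expanding in the singular
value decomposition of `A`, the numbers `‖⟪u i, A w i⟫‖` are dominated by the image of the singular
values under a doubly substochastic array. -/
theorem norm_toLp_inner_le_schattenNorm (q : ℝ≥0∞) [Fact (1 ≤ q)] (A : Matrix m n ℂ)
    {ι : Type*} [Fintype ι]
    {u : ι → EuclideanSpace ℂ m} {w : ι → EuclideanSpace ℂ n} (hu : IsBessel u) (hw : IsBessel w) :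
    ‖(WithLp.toLp q fun i => ‖inner ℂ (u i) (Matrix.toEuclideanLin A (w i))‖ :
      PiLp q fun _ : ι => ℝ)‖ ≤ schattenNorm q A := by
  obtain ⟨e, f, hf, hef, -⟩ := exists_svd A
  set s : Fin (Fintype.card n) → ℝ := fun j => matrixSingularValue A j with hs
  have hs0 : ∀ j, 0 ≤ s j := fun j => matrixSingularValue_nonneg A j
  rw [schattenNorm_eq_norm]
  set p : ι → Fin (Fintype.card n) → ℝ := fun i j =>
    (‖inner ℂ (f j) (u i)‖ ^ 2 + ‖inner ℂ (e j) (w i)‖ ^ 2) / 2 with hp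
  have hsq : ∀ {a : ℝ}, 0 ≤ a → a ≤ 1 → a ^ 2 ≤ 1 := fun h0 h1 => pow_le_one₀ h0 h1
  refine (norm_toLp_mono q (fun i => norm_nonneg _) fun i => ?_).trans
    (norm_toLp_substochastic_le q (p := p) (x := s) (fun i j => by positivity) ?_ ?_ hs0)
  · have h1 : Matrix.toEuclideanLin A (w i) = ∑ j, (inner ℂ (e j) (w i) * s j) • f j := by
      conv_lhs => rw [← e.sum_repr' (w i)]
      rw [map_sum]
      refine Finset.sum_congr rfl fun j _ => ?_
      rw [map_smul, hef, smul_smul]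
    rw [h1, inner_sum]
    refine (norm_sum_le _ _).trans (Finset.sum_le_sum fun j _ => ?_)
    rw [inner_smul_right, norm_mul, norm_mul, Complex.norm_real, Real.norm_of_nonneg (hs0 j),
      norm_inner_symm (u i)]
    have h2 := two_mul_le_add_sq ‖inner ℂ (f j) (u i)‖ ‖inner ℂ (e j) (w i)‖
    have h3 : ‖inner ℂ (e j) (w i)‖ * ‖inner ℂ (f j) (u i)‖ ≤ p i j := by
      simp only [hp]; linarith
    nlinarith [hs0 j]
  · intro i
    have h1 := (hf (u i)).trans (hsq (norm_nonneg _) (hu.norm_le_one i))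
    have h2 := (e.orthonormal.isBessel (w i)).trans (hsq (norm_nonneg _) (hw.norm_le_one i))
    simp only [hp, ← Finset.sum_div, Finset.sum_add_distrib]
    linarith
  · intro j
    have h1 := (hu (f j)).trans (hsq (norm_nonneg _) (hf.norm_le_one j))
    have h2 := (hw (e j)).trans (hsq (norm_nonneg _) (e.orthonormal.isBessel.norm_le_one j))
    simp only [hp, ← Finset.sum_div, Finset.sum_add_distrib]
    simp only [norm_inner_symm (f j), norm_inner_symm (e j)]
    linarith

/-- The variational formula is attained at the singular vectors, simultaneously for all `q`. -/
theorem exists_schattenNorm_eq (A : Matrix m n ℂ) :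
    ∃ (u : Fin (Fintype.card n) → EuclideanSpace ℂ m)
      (w : Fin (Fintype.card n) → EuclideanSpace ℂ n), IsBessel u ∧ Orthonormal ℂ w ∧
      ∀ (q : ℝ≥0∞) [Fact (1 ≤ q)], schattenNorm q A =
        ‖(WithLp.toLp q fun i => ‖inner ℂ (u i) (Matrix.toEuclideanLin A (w i))‖ :
          PiLp q fun _ : Fin (Fintype.card n) => ℝ)‖ := by
  obtain ⟨e, f, hf, -, hef⟩ := exists_svd A
  refine ⟨f, e, hf, e.orthonormal, fun q _ => ?_⟩
  rw [schattenNorm_eq_norm]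
  simp only [hef, Complex.norm_real, Real.norm_of_nonneg (matrixSingularValue_nonneg A _)]
  rfl

theorem schattenNorm_nonneg (q : ℝ≥0∞) [Fact (1 ≤ q)] (A : Matrix m n ℂ) :
    0 ≤ schattenNorm q A := by
  rw [schattenNorm_eq_norm]; exact norm_nonneg _

theorem schattenNorm_add_le (q : ℝ≥0∞) [Fact (1 ≤ q)] (A B : Matrix m n ℂ) :
    schattenNorm q (A + B) ≤ schattenNorm q A + schattenNorm q B := by
  obtain ⟨u, w, hu, hw, h⟩ := exists_schattenNorm_eq (A + B)
  rw [h q]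
  refine le_trans ?_ (add_le_add (norm_toLp_inner_le_schattenNorm q A hu hw.isBessel)
    (norm_toLp_inner_le_schattenNorm q B hu hw.isBessel))
  refine le_trans (norm_toLp_mono q (fun i => norm_nonneg _) fun i => ?_) (norm_add_le _ _)
  rw [map_add, LinearMap.add_apply, inner_add_right]
  exact norm_add_le _ _

theorem schattenNorm_smul_le (q : ℝ≥0∞) [Fact (1 ≤ q)] (c : ℂ) (A : Matrix m n ℂ) :
    schattenNorm q (c • A) ≤ ‖c‖ * schattenNorm q A := by
  obtain ⟨u, w, hu, hw, h⟩ := exists_schattenNorm_eq (c • A)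
  rw [h q]
  have h1 : (WithLp.toLp q fun i => ‖inner ℂ (u i) (Matrix.toEuclideanLin (c • A) (w i))‖ :
      PiLp q fun _ : Fin (Fintype.card n) => ℝ) =
      ‖c‖ • WithLp.toLp q fun i => ‖inner ℂ (u i) (Matrix.toEuclideanLin A (w i))‖ := by
    ext i
    simp
  rw [h1, norm_smul, norm_norm]
  exact mul_le_mul_of_nonneg_left (norm_toLp_inner_le_schattenNorm q A hu hw.isBessel)
    (norm_nonneg _)

theorem schattenNorm_smul (q : ℝ≥0∞) [Fact (1 ≤ q)] (c : ℂ) (A : Matrix m n ℂ) :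
    schattenNorm q (c • A) = ‖c‖ * schattenNorm q A := by
  refine le_antisymm (schattenNorm_smul_le q c A) ?_
  rcases eq_or_ne c 0 with rfl | hc
  · simpa using schattenNorm_nonneg q _
  · have h := schattenNorm_smul_le q c⁻¹ (c • A)
    rw [smul_smul, inv_mul_cancel₀ hc, one_smul, norm_inv] at h
    have hc' : 0 < ‖c‖ := norm_pos_iff.2 hc
    calc ‖c‖ * schattenNorm q A ≤ ‖c‖ * (‖c‖⁻¹ * schattenNorm q (c • A)) := by gcongr
      _ = _ := by rw [← mul_assoc, mul_inv_cancel₀ hc'.ne', one_mul]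

/-- The Schatten norm as a seminorm. -/
def schattenSeminorm (q : ℝ≥0∞) [Fact (1 ≤ q)] : Seminorm ℂ (Matrix m n ℂ) :=
  Seminorm.of (schattenNorm q) (schattenNorm_add_le q) (schattenNorm_smul q)

/-- Right multiplication by an orthogonal projection maps Bessel families to Bessel families, so it
does not increase the Schatten norm. -/
theorem schattenNorm_mul_projection_le (q : ℝ≥0∞) [Fact (1 ≤ q)] (A : Matrix m n ℂ)
    {P : Matrix n n ℂ} (hP : P.IsHermitian) (hPP : P * P = P) :
    schattenNorm q (A * P) ≤ schattenNorm q A := by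
  obtain ⟨u, w, hu, hw, h⟩ := exists_schattenNorm_eq (A * P)
  rw [h q]
  have hmul : ∀ x, Matrix.toEuclideanLin (A * P) x =
      Matrix.toEuclideanLin A (Matrix.toEuclideanLin P x) := by
    intro x
    simp [Matrix.toLpLin_apply, Matrix.mulVec_mulVec]
  have hsymm : ∀ x y, inner ℂ (Matrix.toEuclideanLin P x) y =
      inner ℂ x (Matrix.toEuclideanLin P y) :=
    Matrix.isSymmetric_toEuclideanLin_iff.2 hP
  simp only [hmul]
  refine norm_toLp_inner_le_schattenNorm q A hu (w := fun i => Matrix.toEuclideanLin P (w i)) ?_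
  intro x
  simp only [hsymm]
  refine (hw.isBessel _).trans ?_
  have h1 : ‖Matrix.toEuclideanLin P x‖ ^ 2 ≤ ‖x‖ * ‖Matrix.toEuclideanLin P x‖ := by
    have h2 : inner ℂ (Matrix.toEuclideanLin P x) (Matrix.toEuclideanLin P x) =
        inner ℂ x (Matrix.toEuclideanLin P x) := by
      rw [hsymm]
      simp [Matrix.toLpLin_apply, Matrix.mulVec_mulVec, hPP]
    have h3 := norm_inner_le_norm (𝕜 := ℂ) x (Matrix.toEuclideanLin P x)
    rw [← h2, inner_self_eq_norm_sq_to_K] at h3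
    simpa using h3
  have h2 : ‖Matrix.toEuclideanLin P x‖ ≤ ‖x‖ := by
    by_contra! hlt
    nlinarith [norm_nonneg x]
  gcongr

end SVD

/-! ### Measurability, continuity and Jensen's inequality for Schatten norms -/

instance instBorelSpaceMatrixEntries {m n : Type*} [Countable m] [Countable n] :
    BorelSpace (Matrix m n ℂ) :=
  inferInstanceAs (BorelSpace (m → n → ℂ))

theorem measurable_matrix {δ m n : Type*} [MeasurableSpace δ] {f : δ → Matrix m n ℂ}
    (h : ∀ i j, Measurable fun a => f a i j) : Measurable f :=
  measurable_pi_lambda _ fun i => measurable_pi_lambda _ fun j => h i j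


theorem measurable_entry {m n : Type*} (i : m) (j : n) :
    Measurable fun A : Matrix m n ℂ => A i j :=
  (measurable_pi_apply j).comp (measurable_pi_apply i)

theorem measurable_conj : Measurable (conj : ℂ → ℂ) := Complex.continuous_conj.measurable

section Analysis

variable {m n : Type*} [Fintype m] [Fintype n] [DecidableEq n]

/-- Crude bound by the entries, enough for continuity and integrability. -/
theorem schattenNorm_le_sum [DecidableEq m] (q : ℝ≥0∞) [Fact (1 ≤ q)] (A : Matrix m n ℂ) :
    schattenNorm q A ≤
      ∑ i, ∑ j, ‖A i j‖ * schattenNorm q (Matrix.single i j (1 : ℂ) : Matrix m n ℂ) := by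
  conv_lhs => rw [Matrix.matrix_eq_sum_single A]
  have h : ∀ i j, ‖A i j‖ * schattenNorm q (Matrix.single i j (1 : ℂ) : Matrix m n ℂ) =
      schattenNorm q (Matrix.single i j (A i j)) := by
    intro i j
    rw [← schattenNorm_smul, Matrix.smul_single, smul_eq_mul, mul_one]
  simp only [h]
  change schattenSeminorm q _ ≤ _
  refine (Finset.le_sum_of_subadditive (schattenSeminorm q) (map_zero _).le (map_add_le_add _)
    _ _).trans (Finset.sum_le_sum fun i _ => ?_)
  exact Finset.le_sum_of_subadditive (schattenSeminorm q) (map_zero _).le (map_add_le_add _) _ _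

theorem continuous_schattenNorm (q : ℝ≥0∞) [Fact (1 ≤ q)] :
    Continuous (schattenNorm q : Matrix m n ℂ → ℝ) := by
  classical
  change Continuous (schattenSeminorm q)
  refine Seminorm.continuous_of_continuousAt_zero ?_
  have h : Continuous fun A : Matrix m n ℂ =>
      ∑ i, ∑ j, ‖A i j‖ * schattenNorm q (Matrix.single i j (1 : ℂ) : Matrix m n ℂ) := by
    fun_prop
  have h0 := h.tendsto 0
  simp only [Matrix.zero_apply, norm_zero, zero_mul, Finset.sum_const_zero] at h0
  rw [ContinuousAt, map_zero]
  exact squeeze_zero (fun A => schattenNorm_nonneg q A) (fun A => schattenNorm_le_sum q A) h0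

theorem measurable_schattenNorm (q : ℝ≥0∞) [Fact (1 ≤ q)] :
    Measurable (schattenNorm q : Matrix m n ℂ → ℝ) :=
  (continuous_schattenNorm q).measurable

theorem memLp_schattenNorm {α : Type*} [MeasurableSpace α] {μ : Measure α} {p : ℝ≥0∞}
    (q : ℝ≥0∞) [Fact (1 ≤ q)] {X : α → Matrix m n ℂ} (hX : ∀ i j, MemLp (fun a => X a i j) p μ) :
    MemLp (fun a => schattenNorm q (X a)) p μ := by
  classical
  have h : MemLp (fun a => ∑ i, ∑ j, ‖X a i j‖ *
      schattenNorm q (Matrix.single i j (1 : ℂ) : Matrix m n ℂ)) p μ :=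
    memLp_finsetSum _ fun i _ => memLp_finsetSum _ fun j _ => (hX i j).norm.mul_const _
  have hm : AEMeasurable X μ :=
    aemeasurable_pi_lambda _ fun i => aemeasurable_pi_lambda _ fun j =>
      (hX i j).aestronglyMeasurable.aemeasurable
  refine h.of_le ((measurable_schattenNorm q).comp_aemeasurable hm).aestronglyMeasurable ?_
  refine Filter.Eventually.of_forall fun a => ?_
  rw [Real.norm_of_nonneg (schattenNorm_nonneg q _)]
  exact (schattenNorm_le_sum q _).trans (le_abs_self _)

/-- Jensen's inequality for the Schatten norm of an entrywise expectation. -/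
theorem schattenNorm_integral_le {β : Type*} [MeasurableSpace β] {π : Measure β}
    [IsProbabilityMeasure π] (q : ℝ≥0∞) [Fact (1 ≤ q)] {X : β → Matrix m n ℂ} {M : Matrix m n ℂ}
    (hX : ∀ i j, Integrable (fun b => X b i j) π) (hM : ∀ i j, M i j = ∫ b, X b i j ∂π) :
    schattenNorm q M ≤ ∫ b, schattenNorm q (X b) ∂π := by
  let Y : β → m → n → ℂ := fun b i j => X b i j
  have hXi : Integrable Y π := Integrable.of_eval fun i => Integrable.of_eval fun j => hX i j
  have hMX : M = Matrix.of (∫ b, Y b ∂π) := by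
    ext i j
    rw [hM, Matrix.of_apply, eval_integral (f := Y) fun i => Integrable.of_eval fun j => hX i j,
      eval_integral (f := fun b => Y b i) fun j => hX i j]
  rw [hMX]
  have hN : Integrable (fun b => schattenNorm q (X b)) π :=
    memLp_one_iff_integrable.1 <| memLp_schattenNorm q (X := X) fun i j =>
      memLp_one_iff_integrable.2 (hX i j)
  have hconv : ConvexOn ℝ Set.univ fun f : m → n → ℂ => schattenNorm q (Matrix.of f) :=
    ((schattenSeminorm q).restrictScalars ℝ).convexOn
  have hcont : Continuous fun f : m → n → ℂ => schattenNorm q (Matrix.of f) :=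
    continuous_schattenNorm q
  exact hconv.map_integral_le hcont.continuousOn isClosed_univ (by simp) hXi hN

/-- Conditional Jensen inequality: averaging out the second variable entrywise does not increase the
`L^p` norm of the Schatten norm. -/
theorem eLpNorm_schattenNorm_integral_le {α β : Type*} [MeasurableSpace α] [MeasurableSpace β]
    {μ : Measure α} [SFinite μ] {π : Measure β} [IsProbabilityMeasure π] {p : ℝ≥0∞}
    (hp : 1 ≤ p) (hp' : p ≠ ∞) (q : ℝ≥0∞) [Fact (1 ≤ q)] {X : α → β → Matrix m n ℂ}
    {M : α → Matrix m n ℂ} (hXm : Measurable (Function.uncurry X))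
    (hX : ∀ᵐ a ∂μ, ∀ i j, Integrable (fun b => X a b i j) π)
    (hM : ∀ᵐ a ∂μ, ∀ i j, M a i j = ∫ b, X a b i j ∂π) :
    eLpNorm (fun a => schattenNorm q (M a)) p μ ≤
      eLpNorm (fun z : α × β => schattenNorm q (X z.1 z.2)) p (μ.prod π) := by
  have hp0 : p ≠ 0 := (zero_lt_one.trans_le hp).ne'
  rw [eLpNorm_eq_lintegral_rpow_enorm_toReal hp0 hp',
    eLpNorm_eq_lintegral_rpow_enorm_toReal hp0 hp']
  refine ENNReal.rpow_le_rpow ?_ (by positivity)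
  have hmeas : Measurable fun z : α × β => schattenNorm q (X z.1 z.2) :=
    (measurable_schattenNorm q).comp hXm
  rw [lintegral_prod _ (hmeas.enorm.pow_const _).aemeasurable]
  refine lintegral_mono_ae ?_
  filter_upwards [hX, hM] with a ha hMa
  have hma : AEStronglyMeasurable (fun b => schattenNorm q (X a b)) π :=
    (hmeas.comp measurable_prodMk_left).aestronglyMeasurable
  have h1 : ‖schattenNorm q (M a)‖ₑ ≤ eLpNorm (fun b => schattenNorm q (X a b)) p π := by
    refine le_trans ?_ (eLpNorm_le_eLpNorm_of_exponent_le hp hma)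
    rw [eLpNorm_one_eq_lintegral_enorm]
    refine le_trans ?_ (enorm_integral_le_lintegral_enorm _)
    rw [Real.enorm_of_nonneg (schattenNorm_nonneg q _), Real.enorm_of_nonneg
      (integral_nonneg fun b => schattenNorm_nonneg q _)]
    exact ENNReal.ofReal_le_ofReal (schattenNorm_integral_le q ha hMa)
  refine (ENNReal.rpow_le_rpow h1 ENNReal.toReal_nonneg).trans_eq ?_
  rw [eLpNorm_eq_lintegral_rpow_enorm_toReal hp0 hp', ← ENNReal.rpow_mul, one_div,
    inv_mul_cancel₀ (ENNReal.toReal_pos hp0 hp').ne', ENNReal.rpow_one]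

end Analysis

/-! ### Complex Gaussian vectors -/

section Gaussian

theorem measurable_complex_mk : Measurable fun z : ℝ × ℝ => (⟨z.1, z.2⟩ : ℂ) :=
  Complex.measurableEquivRealProd.symm.measurable

instance instIsProbabilityMeasureComplexGaussian (v : ℝ≥0) :
    IsProbabilityMeasure (complexGaussian v) :=
  Measure.isProbabilityMeasure_map measurable_complex_mk.aemeasurable

theorem charFun_complexGaussian (v : ℝ≥0) (t : ℂ) :
    charFun (complexGaussian v) t = Complex.exp (-(v * ‖t‖ ^ 2 / 4 : ℝ)) := by
  have h1 : charFun (complexGaussian v) t =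
      ∫ z : ℝ × ℝ, Complex.exp (t.re * z.1 * Complex.I) * Complex.exp (t.im * z.2 * Complex.I)
        ∂((gaussianReal 0 (v / 2)).prod (gaussianReal 0 (v / 2))) := by
    rw [charFun_apply, complexGaussian, integral_map measurable_complex_mk.aemeasurable
      (by fun_prop)]
    congr 1 with z
    rw [← Complex.exp_add, Complex.inner]
    congr 1
    simp
    ring
  rw [h1, integral_prod_mul (fun x : ℝ => Complex.exp (t.re * x * Complex.I))
    (fun y : ℝ => Complex.exp (t.im * y * Complex.I)), ← charFun_apply_real, ← charFun_apply_real,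
    charFun_gaussianReal, charFun_gaussianReal, ← Complex.exp_add, ← Complex.normSq_eq_norm_sq,
    Complex.normSq_apply]
  congr 1
  push_cast
  ring

theorem memLp_id_complexGaussian (v : ℝ≥0) {p : ℝ≥0∞} (hp : p ≠ ∞) :
    MemLp id p (complexGaussian v) := by
  rw [complexGaussian, memLp_map_measure_iff (by fun_prop) measurable_complex_mk.aemeasurable]
  have h1 : MemLp (fun z : ℝ × ℝ => (z.1 : ℂ))
      p ((gaussianReal 0 (v / 2)).prod (gaussianReal 0 (v / 2))) :=
    ((memLp_id_gaussianReal' p hp).ofReal (K := ℂ)).comp_fst _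
  have h2 : MemLp (fun z : ℝ × ℝ => Complex.I * (z.2 : ℂ))
      p ((gaussianReal 0 (v / 2)).prod (gaussianReal 0 (v / 2))) :=
    (((memLp_id_gaussianReal' p hp).ofReal (K := ℂ)).comp_snd _).const_mul _
  refine (h1.add h2).ae_eq (Filter.Eventually.of_forall fun z => ?_)
  apply Complex.ext <;> simp

theorem integral_norm_sq_complexGaussian (v : ℝ≥0) :
    ∫ z, ‖z‖ ^ 2 ∂(complexGaussian v) = v := by
  have hg : ∫ x, x ^ 2 ∂(gaussianReal 0 (v / 2)) = v / 2 := by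
    have h := variance_id_gaussianReal (μ := 0) (v := v / 2)
    rw [variance_eq_integral aemeasurable_id] at h
    simpa [integral_id_gaussianReal] using h
  have hi : Integrable (fun x : ℝ => x ^ 2) (gaussianReal 0 (v / 2)) :=
    (memLp_id_gaussianReal' 2 (by simp)).integrable_sq
  rw [complexGaussian, integral_map measurable_complex_mk.aemeasurable (by fun_prop)]
  simp only [← Complex.normSq_eq_norm_sq, Complex.normSq_mk, ← pow_two]
  rw [integral_add (hi.comp_fst _) (hi.comp_snd _), integral_fun_fst (fun x : ℝ => x ^ 2),
    integral_fun_snd (fun x : ℝ => x ^ 2)]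
  simp [hg]

theorem charFun_pi_complexGaussian {ι : Type*} [Fintype ι] (v : ℝ≥0)
    (t : PiLp 2 fun _ : ι => ℂ) :
    charFun ((Measure.pi fun _ : ι => complexGaussian v).map (WithLp.toLp 2)) t =
      Complex.exp (-(v * ‖t‖ ^ 2 / 4 : ℝ)) := by
  rw [charFun_pi]
  simp_rw [charFun_complexGaussian, ← Complex.exp_sum]
  rw [PiLp.norm_sq_eq_of_L2]
  congr 1
  push_cast
  rw [Finset.sum_neg_distrib, Finset.mul_sum, Finset.sum_div]

/-- The law of a vector with i.i.d. complex Gaussian coordinates is preserved by real-linear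
isometries between spaces of equal dimension, since its characteristic function depends on the
Euclidean norm only. -/
theorem map_pi_complexGaussian {ι κ : Type*} [Fintype ι] [Fintype κ] (v : ℝ≥0)
    (hcard : Fintype.card ι = Fintype.card κ) (L : (ι → ℂ) →ₗ[ℝ] (κ → ℂ))
    (hL : ∀ z, ∑ j, ‖L z j‖ ^ 2 = ∑ i, ‖z i‖ ^ 2) :
    (Measure.pi fun _ : ι => complexGaussian v).map L =
      Measure.pi fun _ : κ => complexGaussian v := by
  let Li : PiLp 2 (fun _ : ι => ℂ) →ₗᵢ[ℝ] PiLp 2 (fun _ : κ => ℂ) :=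
    { toFun := fun z => WithLp.toLp 2 (L (WithLp.ofLp z))
      map_add' := fun x y => by simp
      map_smul' := fun c x => by simp
      norm_map' := fun z => by
        have : ‖(WithLp.toLp 2 (L (WithLp.ofLp z)) : PiLp 2 (fun _ : κ => ℂ))‖ = ‖z‖ := by
          rw [PiLp.norm_eq_of_L2, PiLp.norm_eq_of_L2, ← hL]
        simpa using this }
  have hfr : Module.finrank ℝ (PiLp 2 (fun _ : ι => ℂ)) =
      Module.finrank ℝ (PiLp 2 (fun _ : κ => ℂ)) := by
    rw [(WithLp.linearEquiv 2 ℝ (ι → ℂ)).finrank_eq, (WithLp.linearEquiv 2 ℝ (κ → ℂ)).finrank_eq]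
    simp [Module.finrank_pi_fintype, hcard]
  let Le := Li.toLinearIsometryEquiv hfr
  have hLm : Measurable L := (LinearMap.continuous_of_finiteDimensional L).measurable
  have hP : IsProbabilityMeasure ((Measure.pi fun _ : ι => complexGaussian v).map L) :=
    Measure.isProbabilityMeasure_map hLm.aemeasurable
  refine (MeasurableEquiv.toLp 2 (κ → ℂ)).map_measurableEquiv_injective
    (Measure.ext_of_charFun (funext fun t => ?_))
  have hLe : ∀ z : ι → ℂ, WithLp.toLp 2 (L z) = Le (WithLp.toLp 2 z) := fun z => rfl
  rw [MeasurableEquiv.coe_toLp, charFun_pi_complexGaussian, charFun_apply,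
    Measure.map_map (by fun_prop) hLm, integral_map (by fun_prop) (by fun_prop)]
  simp only [Function.comp_apply, hLe]
  have hadj : ∀ z, inner ℝ (Le z) t = inner ℝ z (Le.symm t) := fun z => by
    rw [← Le.inner_map_map, Le.apply_symm_apply]
  simp only [hadj]
  rw [← Le.symm.norm_map t, ← charFun_pi_complexGaussian, charFun_apply,
    integral_map (by fun_prop) (by fun_prop)]

end Gaussian

/-! ### Gaussian matrices -/

theorem measurable_fromRows {α α' β : Type*} :
    Measurable fun G : Matrix α β ℂ × Matrix α' β ℂ => Matrix.fromRows G.1 G.2 := by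
  refine measurable_matrix fun i j => ?_
  cases i with
  | inl i => exact (measurable_entry i j).comp measurable_fst
  | inr i => exact (measurable_entry i j).comp measurable_snd

section GaussianMatrix

variable {α β α' β' κ : Type*} [Fintype α] [Fintype β] [Fintype α'] [Fintype β'] [Fintype κ]

/-- The law of a matrix with i.i.d. complex Gaussian entries, over arbitrary finite index types. -/
def gaussianMatrix (α β : Type*) [Fintype α] [Fintype β] (v : ℝ≥0) : Measure (Matrix α β ℂ) :=
  Measure.pi fun _ : α => Measure.pi fun _ : β => complexGaussian v

instance instIsProbabilityMeasureGaussianMatrix (v : ℝ≥0) :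
    IsProbabilityMeasure (gaussianMatrix α β v) :=
  inferInstanceAs (IsProbabilityMeasure (Measure.pi fun _ : α => Measure.pi fun _ : β =>
    complexGaussian v))

theorem ginibre_eq_gaussianMatrix (M N : ℕ) (v : ℝ≥0) :
    ginibre M N v = gaussianMatrix (Fin M) (Fin N) v := rfl

/-- Currying preserves product measures. -/
theorem map_curry_pi {X : Type*} [MeasurableSpace X] (μ : Measure X) [IsProbabilityMeasure μ] :
    (Measure.pi fun _ : α × β => μ).map (MeasurableEquiv.curry α β X) =
      Measure.pi fun _ : α => Measure.pi fun _ : β => μ := by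
  have h := Measure.infinitePi_map_curry (fun (_ : α) (_ : β) => μ)
  simpa only [Measure.infinitePi_eq_pi] using h

/-- Gaussian matrices are invariant under real-linear maps preserving the Hilbert–Schmidt norm. All
the distributional identities below are instances of this. -/
theorem map_gaussianMatrix (v : ℝ≥0)
    (hcard : Fintype.card α * Fintype.card β = Fintype.card α' * Fintype.card β')
    (L : Matrix α β ℂ →ₗ[ℝ] Matrix α' β' ℂ)
    (hL : ∀ G, ∑ i, ∑ j, ‖L G i j‖ ^ 2 = ∑ i, ∑ j, ‖G i j‖ ^ 2) :
    (gaussianMatrix α β v).map L = gaussianMatrix α' β' v := by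
  let L' : (α × β → ℂ) →ₗ[ℝ] (α' × β' → ℂ) :=
    { toFun := fun z x => L (Matrix.of fun i j => z (i, j)) x.1 x.2
      map_add' := fun x y => by
        funext z
        exact congrFun (congrFun (L.map_add (Matrix.of fun i j => x (i, j))
          (Matrix.of fun i j => y (i, j))) z.1) z.2
      map_smul' := fun c x => by
        funext z
        exact congrFun (congrFun (L.map_smul c (Matrix.of fun i j => x (i, j))) z.1) z.2 }
  have h := map_pi_complexGaussian v (by simpa using hcard) L' fun z => by
    rw [Fintype.sum_prod_type, Fintype.sum_prod_type]
    exact hL _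
  have hLm : Measurable L := (LinearMap.continuous_of_finiteDimensional L).measurable
  have hLm' : Measurable L' := (LinearMap.continuous_of_finiteDimensional L').measurable
  unfold gaussianMatrix
  rw [← map_curry_pi, ← map_curry_pi, ← h, Measure.map_map (by fun_prop) hLm']
  exact Measure.map_map hLm (MeasurableEquiv.measurable _)

theorem gaussianMatrix_map_reindex (v : ℝ≥0) (e : α ≃ α') :
    (gaussianMatrix α β v).map (fun G => G.submatrix e.symm id) = gaussianMatrix α' β v := by
  refine map_gaussianMatrix v (by rw [Fintype.card_congr e])
    { toFun := fun G => G.submatrix e.symm id, map_add' := fun _ _ => rfl,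
      map_smul' := fun _ _ => rfl } fun G => ?_
  exact e.symm.sum_comp fun i => ∑ j, ‖G i j‖ ^ 2

theorem sum_norm_sq_eq_trace (G : Matrix α β ℂ) :
    ((∑ i, ∑ j, ‖G i j‖ ^ 2 : ℝ) : ℂ) = (Gᴴ * G).trace := by
  simp only [Matrix.trace, Matrix.diag_apply, Matrix.mul_apply, Matrix.conjTranspose_apply]
  rw [Finset.sum_comm]
  push_cast
  refine Finset.sum_congr rfl fun i _ => Finset.sum_congr rfl fun j _ => ?_
  rw [← Complex.conj_mul']
  rfl

theorem gaussianMatrix_map_mul_left [DecidableEq α] (v : ℝ≥0) {U : Matrix α α ℂ}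
    (hU : U ∈ Matrix.unitaryGroup α ℂ) :
    (gaussianMatrix α β v).map (fun G => U * G) = gaussianMatrix α β v := by
  refine map_gaussianMatrix v rfl
    { toFun := fun G => U * G, map_add' := Matrix.mul_add U,
      map_smul' := fun c G => Matrix.mul_smul U c G } fun G => ?_
  have h : ((∑ i, ∑ j, ‖(U * G) i j‖ ^ 2 : ℝ) : ℂ) = (∑ i, ∑ j, ‖G i j‖ ^ 2 : ℝ) := by
    rw [sum_norm_sq_eq_trace, sum_norm_sq_eq_trace, Matrix.conjTranspose_mul, Matrix.mul_assoc,
      ← Matrix.mul_assoc Uᴴ, ← Matrix.star_eq_conjTranspose U, Matrix.mem_unitaryGroup_iff'.1 hU,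
      Matrix.one_mul]
  exact_mod_cast h

theorem gaussianMatrix_map_mul_right [DecidableEq β] (v : ℝ≥0) {U : Matrix β β ℂ}
    (hU : U ∈ Matrix.unitaryGroup β ℂ) :
    (gaussianMatrix α β v).map (fun G => G * U) = gaussianMatrix α β v := by
  refine map_gaussianMatrix v rfl
    { toFun := fun G => G * U, map_add' := fun A B => Matrix.add_mul A B U,
      map_smul' := fun c G => Matrix.smul_mul c G U } fun G => ?_
  have h : ((∑ i, ∑ j, ‖(G * U) i j‖ ^ 2 : ℝ) : ℂ) = (∑ i, ∑ j, ‖G i j‖ ^ 2 : ℝ) := by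
    rw [sum_norm_sq_eq_trace, sum_norm_sq_eq_trace, Matrix.conjTranspose_mul, Matrix.mul_assoc,
      Matrix.trace_mul_comm, Matrix.mul_assoc, Matrix.mul_assoc, ← Matrix.star_eq_conjTranspose U,
      Matrix.mem_unitaryGroup_iff.1 hU, Matrix.mul_one]
  exact_mod_cast h

theorem gaussianMatrix_map_conj (v : ℝ≥0) :
    (gaussianMatrix α β v).map (fun G => G.map conj) = gaussianMatrix α β v := by
  refine map_gaussianMatrix v rfl
    { toFun := fun G => G.map conj, map_add' := fun A B => by ext; simp,
      map_smul' := fun c G => by ext; simp } fun G => ?_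
  simp

/-- Stacking two independent Gaussian matrices gives a Gaussian matrix. -/
theorem gaussianMatrix_prod_map_fromRows (v : ℝ≥0) :
    ((gaussianMatrix α β v).prod (gaussianMatrix α' β v)).map
      (fun G => Matrix.fromRows G.1 G.2) = gaussianMatrix (α ⊕ α') β v := by
  have h := (measurePreserving_sumPiEquivProdPi_symm (X := fun _ : α ⊕ α' => β → ℂ)
    (fun _ => Measure.pi fun _ : β => complexGaussian v)).map_eq
  refine Eq.trans ?_ h
  congr 1

/-- The normalized sum and difference of two independent copies of a Gaussian matrix are again two
independent copies. -/
theorem gaussianMatrix_prod_map_rotation (v : ℝ≥0) :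
    ((gaussianMatrix α β v).prod (gaussianMatrix α β v)).map
      (fun G => (((√2)⁻¹ : ℝ) • (G.1 + G.2), ((√2)⁻¹ : ℝ) • (G.1 - G.2))) =
      (gaussianMatrix α β v).prod (gaussianMatrix α β v) := by
  set γ := gaussianMatrix α β v with hγ
  let R : Matrix (α ⊕ α) β ℂ →ₗ[ℝ] Matrix (α ⊕ α) β ℂ :=
    { toFun := fun G => Matrix.fromRows (((√2)⁻¹ : ℝ) • (G.toRows₁ + G.toRows₂))
        (((√2)⁻¹ : ℝ) • (G.toRows₁ - G.toRows₂))
      map_add' := fun A B => by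
        ext (i | i) j <;> simp [Matrix.toRows₁, Matrix.toRows₂] <;> ring
      map_smul' := fun c A => by
        ext (i | i) j <;> simp [Matrix.toRows₁, Matrix.toRows₂] <;> ring }
  have hR := map_gaussianMatrix v rfl R fun G => by
    rw [Fintype.sum_sum_type, Fintype.sum_sum_type, ← Finset.sum_add_distrib,
      ← Finset.sum_add_distrib]
    refine Finset.sum_congr rfl fun i _ => ?_
    rw [← Finset.sum_add_distrib, ← Finset.sum_add_distrib]
    refine Finset.sum_congr rfl fun j _ => ?_
    have h1 : R G (Sum.inl i) j = ((√2)⁻¹ : ℝ) • (G (Sum.inl i) j + G (Sum.inr i) j) := rfl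
    have h2 : R G (Sum.inr i) j = ((√2)⁻¹ : ℝ) • (G (Sum.inl i) j - G (Sum.inr i) j) := rfl
    rw [h1, h2, norm_smul, norm_smul, mul_pow, mul_pow, ← mul_add]
    have h3 : ∀ a b : ℂ, ‖a + b‖ ^ 2 + ‖a - b‖ ^ 2 = 2 * (‖a‖ ^ 2 + ‖b‖ ^ 2) := fun a b => by
      simpa only [← pow_two] using parallelogram_law_with_norm ℝ a b
    rw [h3, Real.norm_of_nonneg (by positivity), inv_pow, Real.sq_sqrt (by norm_num)]
    ring
  have hS : Measurable fun G : Matrix (α ⊕ α) β ℂ => (G.toRows₁, G.toRows₂) := by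
    exact Measurable.prodMk (measurable_matrix fun i j => measurable_entry (Sum.inl i) j)
      (measurable_matrix fun i j => measurable_entry (Sum.inr i) j)
  have hS' : ((gaussianMatrix (α ⊕ α) β v)).map (fun G => (G.toRows₁, G.toRows₂)) = γ.prod γ := by
    rw [← gaussianMatrix_prod_map_fromRows, Measure.map_map hS measurable_fromRows]
    simp [Function.comp_def, hγ]
  have hRm : Measurable R := (LinearMap.continuous_of_finiteDimensional R).measurable
  conv_rhs => rw [← hS', ← hR, Measure.map_map hS hRm, ← gaussianMatrix_prod_map_fromRows,
    Measure.map_map (hS.comp hRm) measurable_fromRows]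
  rfl

/-- The matrix whose blocks are independent Gaussian matrices is Gaussian. -/
theorem pi_gaussianMatrix_map (v : ℝ≥0) :
    (Measure.pi fun _ : κ => gaussianMatrix α β v).map
      (fun W => Matrix.of fun (x : α × κ) j => W x.2 x.1 j) = gaussianMatrix (α × κ) β v := by
  have h : (gaussianMatrix (κ × α) β v).map (MeasurableEquiv.curry κ α (β → ℂ)) =
    (Measure.pi fun _ : κ => gaussianMatrix α β v) := map_curry_pi _
  rw [← h]
  refine (Measure.map_map ?_ (MeasurableEquiv.measurable _)).trans ?_
  · exact measurable_matrix fun i j => (measurable_entry i.1 j).comp (measurable_pi_apply i.2)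
  · exact gaussianMatrix_map_reindex v (Equiv.prodComm κ α)

theorem gaussianMatrix_map_entry (v : ℝ≥0) (i : α) (j : β) :
    (gaussianMatrix α β v).map (fun G => G i j) = complexGaussian v :=
  ((measurePreserving_eval (fun _ : β => complexGaussian v) j).comp
    (measurePreserving_eval (fun _ : α => Measure.pi fun _ : β => complexGaussian v) i)).map_eq

theorem memLp_entry_gaussianMatrix (v : ℝ≥0) {p : ℝ≥0∞} (hp : p ≠ ∞) (i : α) (j : β) :
    MemLp (fun G : Matrix α β ℂ => G i j) p (gaussianMatrix α β v) := by
  have h := memLp_id_complexGaussian v hp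
  rw [← gaussianMatrix_map_entry v i j, memLp_map_measure_iff (by fun_prop)
    (measurable_entry i j).aemeasurable] at h
  exact h

theorem integral_norm_sq_entry_gaussianMatrix (v : ℝ≥0) (i : α) (j : β) :
    ∫ G, ‖G i j‖ ^ 2 ∂(gaussianMatrix α β v) = v := by
  rw [← integral_norm_sq_complexGaussian v, ← gaussianMatrix_map_entry v i j,
    integral_map (measurable_entry i j).aemeasurable (by fun_prop)]

/-- Entries of a Gaussian matrix are uncorrelated. -/
theorem integral_mul_conj_gaussianMatrix [DecidableEq α] [DecidableEq β] (v : ℝ≥0)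
    (x y : α × β) :
    ∫ G, G x.1 x.2 * conj (G y.1 y.2) ∂(gaussianMatrix α β v) = if x = y then (v : ℂ) else 0 := by
  split_ifs with h
  · subst h
    simp only [Complex.mul_conj']
    have h := congrArg ((↑) : ℝ → ℂ) (integral_norm_sq_entry_gaussianMatrix v x.1 x.2)
    rw [← integral_complex_ofReal] at h
    simpa using h
  · -- Flipping the sign of the entry `x` preserves the law and negates the integral.
    let L : Matrix α β ℂ →ₗ[ℝ] Matrix α β ℂ :=
      { toFun := fun G => Matrix.of fun i j => if (i, j) = x then -G i j else G i j
        map_add' := fun A B => by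
          ext i j
          simp only [Matrix.of_apply, Matrix.add_apply]
          split_ifs <;> ring
        map_smul' := fun c A => by ext i j; simp }
    have hL := map_gaussianMatrix v rfl L fun G => by
      refine Finset.sum_congr rfl fun i _ => Finset.sum_congr rfl fun j _ => ?_
      change ‖if (i, j) = x then -G i j else G i j‖ ^ 2 = _
      split_ifs <;> simp
    have hm : Measurable fun G : Matrix α β ℂ => G x.1 x.2 * conj (G y.1 y.2) :=
      (measurable_entry _ _).mul (measurable_conj.comp (measurable_entry _ _))
    have hLm : Measurable L := (LinearMap.continuous_of_finiteDimensional L).measurable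
    have h1 : ∫ G, G x.1 x.2 * conj (G y.1 y.2) ∂(gaussianMatrix α β v) =
        -∫ G, G x.1 x.2 * conj (G y.1 y.2) ∂(gaussianMatrix α β v) := by
      conv_lhs => rw [← hL, integral_map hLm.aemeasurable hm.aestronglyMeasurable]
      rw [← integral_neg]
      congr 1 with G
      have hx : L G x.1 x.2 = -G x.1 x.2 := by simp [L]
      have hy : L G y.1 y.2 = G y.1 y.2 := by simp [L, Ne.symm h]
      rw [hx, hy, neg_mul]
    exact self_eq_neg.1 h1

end GaussianMatrix

/-! ### Absolute value of a matrix and the law of the polar decomposition -/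

section Abs
variable {α β : Type*} [Fintype α] [Fintype β] [DecidableEq β]

open scoped MatrixOrder ComplexOrder in
/-- The absolute value `|G| = (Gᴴ G)^(1/2)`, a square matrix indexed by the columns of `G`. -/
def matrixAbs (G : Matrix α β ℂ) : Matrix β β ℂ := CFC.sqrt (Gᴴ * G)

section
open scoped MatrixOrder ComplexOrder Matrix.Norms.L2Operator

theorem continuous_matrixAbs : Continuous (fun G : Matrix α β ℂ => matrixAbs G) := by
  unfold matrixAbs
  simp only [CFC.sqrt]
  refine Continuous.cfcₙ_nnreal_of_mem_nhdsSet (s := Set.univ) _ (by simp) (by fun_prop) ?_ ?_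
  · intro G
    exact (Matrix.posSemidef_conjTranspose_mul_self G).nonneg
  · exact NNReal.continuous_sqrt.continuousOn
end

theorem measurable_matrixAbs : Measurable (matrixAbs : Matrix α β ℂ → Matrix β β ℂ) :=
  Continuous.measurable continuous_matrixAbs

open scoped MatrixOrder ComplexOrder

theorem posSemidef_matrixAbs (G : Matrix α β ℂ) : (matrixAbs G).PosSemidef :=
  Matrix.nonneg_iff_posSemidef.1 (CFC.sqrt_nonneg (Gᴴ * G))

theorem isHermitian_matrixAbs (G : Matrix α β ℂ) : (matrixAbs G)ᴴ = matrixAbs G :=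
  (posSemidef_matrixAbs G).isHermitian.eq

theorem matrixAbs_mul_self (G : Matrix α β ℂ) : matrixAbs G * matrixAbs G = Gᴴ * G :=
  CFC.sqrt_mul_sqrt_self _ (Matrix.posSemidef_conjTranspose_mul_self G).nonneg

theorem matrixAbs_eq_of_mul_self {G : Matrix α β ℂ} {H : Matrix β β ℂ} (hH : H.PosSemidef)
    (h : H * H = Gᴴ * G) : matrixAbs G = H :=
  CFC.sqrt_unique h hH.nonneg

theorem matrixAbs_mul_unitary (G : Matrix α β ℂ) {U : Matrix β β ℂ}
    (hU : U ∈ Matrix.unitaryGroup β ℂ) : matrixAbs (G * U) = Uᴴ * matrixAbs G * U := by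
  refine matrixAbs_eq_of_mul_self ((posSemidef_matrixAbs G).conjTranspose_mul_mul_same U) ?_
  have h : U * Uᴴ = 1 := Matrix.mem_unitaryGroup_iff.1 hU
  calc Uᴴ * matrixAbs G * U * (Uᴴ * matrixAbs G * U)
      = Uᴴ * matrixAbs G * (U * Uᴴ) * matrixAbs G * U := by simp only [Matrix.mul_assoc]
    _ = Uᴴ * (matrixAbs G * matrixAbs G) * U := by rw [h, Matrix.mul_one, Matrix.mul_assoc Uᴴ]
    _ = _ := by rw [matrixAbs_mul_self, Matrix.conjTranspose_mul]; simp only [Matrix.mul_assoc]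

end Abs

section Unitary
variable {α β : Type*} [Fintype α] [Fintype β] [DecidableEq α] [DecidableEq β]

/-- Two matrices with the same Gram matrix differ by a unitary. -/
theorem exists_unitary_mul_eq {A B : Matrix α β ℂ} (h : Aᴴ * A = Bᴴ * B) :
    ∃ U ∈ Matrix.unitaryGroup α ℂ, U * B = A := by
  set a := Matrix.toEuclideanLin A with ha
  set b := Matrix.toEuclideanLin B with hb
  have hadj : ∀ (C : Matrix α β ℂ) x, ‖Matrix.toEuclideanLin C x‖ ^ 2 =
      RCLike.re (inner ℂ x (Matrix.toEuclideanLin (Cᴴ * C) x)) := by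
    intro C x
    have h1 : Matrix.toEuclideanLin (Cᴴ * C) x =
        LinearMap.adjoint (Matrix.toEuclideanLin C) (Matrix.toEuclideanLin C x) := by
      rw [← Matrix.toEuclideanLin_conjTranspose_eq_adjoint]
      simp [Matrix.toLpLin_apply, Matrix.mulVec_mulVec]
    rw [h1, LinearMap.adjoint_inner_right, inner_self_eq_norm_sq]
  have hnorm : ∀ x, ‖a x‖ = ‖b x‖ := fun x => by
    have : ‖a x‖ ^ 2 = ‖b x‖ ^ 2 := by rw [ha, hb, hadj, hadj, h]
    exact (pow_left_inj₀ (norm_nonneg _) (norm_nonneg _) two_ne_zero).1 this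
  obtain ⟨g, hg⟩ := b.rangeRestrict.exists_rightInverse_of_surjective b.range_rangeRestrict
  have hbg : ∀ s : b.range, b (g s) = s := fun s =>
    congrArg Subtype.val (LinearMap.congr_fun hg s)
  let L : b.range →ₗᵢ[ℂ] EuclideanSpace ℂ α :=
    { toLinearMap := a ∘ₗ g
      norm_map' := fun s => by
        rw [LinearMap.comp_apply, hnorm, hbg]; rfl }
  have hLb : ∀ x, L.extend (b x) = a x := fun x => by
    have h1 : L.extend (b x) = L ⟨b x, LinearMap.mem_range_self b x⟩ :=
      L.extend_apply ⟨b x, LinearMap.mem_range_self b x⟩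
    have h2 : a (g ⟨b x, LinearMap.mem_range_self b x⟩) - a x = 0 := by
      rw [← map_sub, ← norm_eq_zero, hnorm, map_sub, hbg, sub_self, norm_zero]
    rw [h1]
    exact sub_eq_zero.1 h2
  set U := Matrix.toEuclideanLin.symm L.extend.toLinearMap with hU
  have hUL : Matrix.toEuclideanLin U = L.extend.toLinearMap := by simp [hU]
  refine ⟨U, ?_, ?_⟩
  · rw [Matrix.mem_unitaryGroup_iff', Matrix.star_eq_conjTranspose]
    apply Matrix.toEuclideanLin.injective
    refine LinearMap.ext fun x => ?_
    have h1 : Matrix.toEuclideanLin (Uᴴ * U) x =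
        LinearMap.adjoint L.extend.toLinearMap (L.extend.toLinearMap x) := by
      rw [← hUL, ← Matrix.toEuclideanLin_conjTranspose_eq_adjoint]
      simp [Matrix.toLpLin_apply, Matrix.mulVec_mulVec]
    rw [h1]
    refine ext_inner_left ℂ fun y => ?_
    rw [LinearMap.adjoint_inner_right]
    have : Matrix.toEuclideanLin (1 : Matrix α α ℂ) x = x := by simp
    rw [this]
    exact L.extend.inner_map_map y x
  · apply Matrix.toEuclideanLin.injective
    refine LinearMap.ext fun x => ?_
    have h1 : Matrix.toEuclideanLin (U * B) x =
        Matrix.toEuclideanLin U (Matrix.toEuclideanLin B x) := by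
      simp [Matrix.toLpLin_apply, Matrix.mulVec_mulVec]
    rw [h1, hUL]
    exact hLb x

instance instSecondCountableTopologyMatrix {m n : Type*} [Countable m] [Countable n] :
    SecondCountableTopology (Matrix m n ℂ) :=
  inferInstanceAs (SecondCountableTopology (m → n → ℂ))

instance instCompactSpaceUnitaryGroup : CompactSpace (Matrix.unitaryGroup α ℂ) := by
  refine isCompact_iff_compactSpace (s := (Matrix.unitaryGroup α ℂ : Set (Matrix α α ℂ))).1 ?_
  have hK : IsCompact (Set.univ.pi fun _ : α => Set.univ.pi fun _ : α =>
      Metric.closedBall (0 : ℂ) 1) :=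
    isCompact_univ_pi fun _ => isCompact_univ_pi fun _ => isCompact_closedBall _ _
  refine IsCompact.of_isClosed_subset (X := Matrix α α ℂ) hK ?_ ?_
  · have : (Matrix.unitaryGroup α ℂ : Set (Matrix α α ℂ)) = {U | U * star U = 1} := by
      ext U; exact Matrix.mem_unitaryGroup_iff
    rw [this]
    exact isClosed_eq (by fun_prop) continuous_const
  · intro U hU i _ j _
    rw [mem_closedBall_zero_iff]
    exact entry_norm_bound_of_unitary hU i j

/-- If `V` is a random isometry whose law is invariant under left multiplication by unitaries and
`G` is an independent Gaussian matrix, then `V |G|` has the law of `G`. For a fixed `G` the matrices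
`V |G|` and `G` have the same Gram matrix, hence lie in one orbit of the unitary group, so `V |G|`
is distributed as `U G` with `U` a Haar unitary; and `U G` has the law of `G`. -/
theorem map_isometry_mul_matrixAbs (v : ℝ≥0) {ν : Measure (Matrix α β ℂ)} [IsProbabilityMeasure ν]
    (hiso : ∀ᵐ V ∂ν, Vᴴ * V = 1)
    (hinv : ∀ U ∈ Matrix.unitaryGroup α ℂ, ν.map (fun V => U * V) = ν) :
    (ν.prod (gaussianMatrix α β v)).map (fun z => z.1 * matrixAbs z.2) = gaussianMatrix α β v := by
  set γ := gaussianMatrix α β v with hγ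
  -- The orbit average below is over `U⁻¹`, so that left invariance of `η` absorbs the unitary
  -- taking `V |G|` to `G`.
  let η : Measure (Matrix.unitaryGroup α ℂ) := Measure.haarMeasure ⊤
  have hη : IsProbabilityMeasure η := ⟨by
    have := Measure.haarMeasure_self (K₀ := (⊤ : TopologicalSpace.PositiveCompacts
      (Matrix.unitaryGroup α ℂ)))
    simpa using this⟩
  have hmul : Measurable fun z : Matrix α β ℂ × Matrix α β ℂ => z.1 * matrixAbs z.2 := by
    have : Continuous fun z : Matrix α β ℂ × Matrix β β ℂ => z.1 * z.2 := by fun_prop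
    exact this.measurable.comp
      (measurable_fst.prodMk (measurable_matrixAbs.comp measurable_snd))
  have hact : Measurable fun z : Matrix.unitaryGroup α ℂ × Matrix α β ℂ =>
      ((z.1⁻¹ : Matrix.unitaryGroup α ℂ) : Matrix α α ℂ) * z.2 := by
    have : Continuous fun z : Matrix.unitaryGroup α ℂ × Matrix α β ℂ =>
      ((z.1⁻¹ : Matrix.unitaryGroup α ℂ) : Matrix α α ℂ) * z.2 := by fun_prop
    exact this.measurable
  refine Measure.ext_of_lintegral _ fun f hf => ?_
  have hleft : ∀ U ∈ Matrix.unitaryGroup α ℂ, Measurable fun W : Matrix α β ℂ => U * W := by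
    intro U _
    have : Continuous fun W : Matrix α β ℂ => U * W := by fun_prop
    exact this.measurable
  have key : ∀ G : Matrix α β ℂ, ∫⁻ V, f (V * matrixAbs G) ∂ν =
      ∫⁻ U, f (((U⁻¹ : Matrix.unitaryGroup α ℂ) : Matrix α α ℂ) * G) ∂η := by
    intro G
    have hmG : Measurable fun V : Matrix α β ℂ => f (V * matrixAbs G) :=
      hf.comp (hmul.comp (measurable_id.prodMk measurable_const))
    have h1 : ∀ᵐ V ∂ν, ∫⁻ U, f (((U⁻¹ : Matrix.unitaryGroup α ℂ) : Matrix α α ℂ) * G) ∂η =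
        ∫⁻ U, f (((U⁻¹ : Matrix.unitaryGroup α ℂ) : Matrix α α ℂ) * (V * matrixAbs G)) ∂η := by
      filter_upwards [hiso] with V hV
      obtain ⟨W, hW, hWG⟩ := exists_unitary_mul_eq (A := G) (B := V * matrixAbs G) (by
        rw [Matrix.conjTranspose_mul, Matrix.mul_assoc, ← Matrix.mul_assoc Vᴴ, hV, Matrix.one_mul,
          isHermitian_matrixAbs, matrixAbs_mul_self])
      rw [← lintegral_mul_left_eq_self _ (⟨W, hW⟩ : Matrix.unitaryGroup α ℂ)]
      refine lintegral_congr fun U => ?_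
      congr 1
      have hinvW : ((((⟨W, hW⟩ : Matrix.unitaryGroup α ℂ) * U)⁻¹ : Matrix.unitaryGroup α ℂ) :
          Matrix α α ℂ) = ((U⁻¹ : Matrix.unitaryGroup α ℂ) : Matrix α α ℂ) * star W := by
        rw [_root_.mul_inv_rev]; rfl
      have hWG' : star W * G = V * matrixAbs G := by
        conv_lhs => rw [← hWG]
        rw [← Matrix.mul_assoc, Matrix.mem_unitaryGroup_iff'.1 hW, Matrix.one_mul]
      rw [hinvW, Matrix.mul_assoc, hWG']
    calc ∫⁻ V, f (V * matrixAbs G) ∂ν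
        = ∫⁻ U, ∫⁻ V, f (((U⁻¹ : Matrix.unitaryGroup α ℂ) : Matrix α α ℂ) *
            (V * matrixAbs G)) ∂ν ∂η := by
          have : ∀ U : Matrix.unitaryGroup α ℂ,
              ∫⁻ V, f (((U⁻¹ : Matrix.unitaryGroup α ℂ) : Matrix α α ℂ) * (V * matrixAbs G)) ∂ν =
              ∫⁻ V, f (V * matrixAbs G) ∂ν := by
            intro U
            conv_rhs => rw [← hinv _ (U⁻¹).2, lintegral_map hmG (hleft _ (U⁻¹).2)]
            simp only [Matrix.mul_assoc]
          simp only [this, lintegral_const, measure_univ, mul_one]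
      _ = ∫⁻ V, ∫⁻ U, f (((U⁻¹ : Matrix.unitaryGroup α ℂ) : Matrix α α ℂ) *
            (V * matrixAbs G)) ∂η ∂ν := by
          refine lintegral_lintegral_swap (Measurable.aemeasurable ?_)
          exact hf.comp (hact.comp (measurable_fst.prodMk
            (hmul.comp (measurable_snd.prodMk measurable_const))))
      _ = ∫⁻ V, ∫⁻ U, f (((U⁻¹ : Matrix.unitaryGroup α ℂ) : Matrix α α ℂ) * G) ∂η ∂ν :=
          (lintegral_congr_ae h1).symm
      _ = _ := by simp only [lintegral_const, measure_univ, mul_one]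
  rw [lintegral_map hf hmul, lintegral_prod_symm
    (fun z : Matrix α β ℂ × Matrix α β ℂ => f (z.1 * matrixAbs z.2))
    (hf.comp hmul).aemeasurable]
  simp only [key]
  rw [lintegral_lintegral_swap (f := fun (G : Matrix α β ℂ) (U : Matrix.unitaryGroup α ℂ) =>
    f (((U⁻¹ : Matrix.unitaryGroup α ℂ) : Matrix α α ℂ) * G))
    (hf.comp (hact.comp measurable_swap)).aemeasurable]
  have : ∀ U : Matrix.unitaryGroup α ℂ,
      ∫⁻ G, f (((U⁻¹ : Matrix.unitaryGroup α ℂ) : Matrix α α ℂ) * G) ∂γ = ∫⁻ G, f G ∂γ := by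
    intro U
    conv_rhs => rw [hγ, ← gaussianMatrix_map_mul_left v (U⁻¹).2,
      lintegral_map hf (hleft _ (U⁻¹).2)]
  simp only [this, lintegral_const, measure_univ, mul_one]

end Unitary

/-! ### Matrices commuting with all `U ⊗ conj U` -/

section Commutant
variable {β : Type*} [DecidableEq β]

/-- The matrix of the permutation `σ`, with entries `1` at the positions `(i, σ i)`. With this
convention `σ ↦ permutationMatrix σ` reverses products. -/
def permutationMatrix (σ : Equiv.Perm β) : Matrix β β ℂ :=
  Matrix.of fun i j => if σ i = j then 1 else 0

theorem permutationMatrix_one : permutationMatrix (1 : Equiv.Perm β) = 1 := by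
  ext i j
  simp only [permutationMatrix, Matrix.of_apply, Equiv.Perm.one_apply, Matrix.one_apply]
  congr

theorem permutationMatrix_map_conj (σ : Equiv.Perm β) :
    (permutationMatrix σ).map conj = permutationMatrix σ := by
  ext i j; simp [permutationMatrix, apply_ite]

theorem permutationMatrix_kronecker (σ τ : Equiv.Perm β) :
    permutationMatrix σ ⊗ₖ permutationMatrix τ = permutationMatrix (Equiv.prodCongr σ τ) := by
  ext ⟨a, b⟩ ⟨c, e⟩
  simp only [permutationMatrix, Matrix.kroneckerMap_apply, Matrix.of_apply, Equiv.prodCongr_apply,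
    Prod.map_apply, Prod.mk.injEq, ite_and, mul_ite, mul_one, mul_zero]
  split_ifs <;> rfl

theorem permutationMatrix_conjTranspose (σ : Equiv.Perm β) :
    (permutationMatrix σ)ᴴ = permutationMatrix σ⁻¹ := by
  ext i j
  have h : σ⁻¹ i = j ↔ σ j = i := by rw [Equiv.Perm.inv_eq_iff_eq, eq_comm]
  simp only [permutationMatrix, Matrix.conjTranspose_apply, Matrix.of_apply]
  by_cases hji : σ j = i
  · rw [if_pos hji, if_pos (h.2 hji), star_one]
  · rw [if_neg hji, if_neg (mt h.1 hji), star_zero]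

variable [Fintype β]

theorem permutationMatrix_mul_apply {κ : Type*} (σ : Equiv.Perm β) (T : Matrix β κ ℂ) (i : β)
    (j : κ) : (permutationMatrix σ * T) i j = T (σ i) j := by
  simp [permutationMatrix, Matrix.mul_apply]

theorem mul_permutationMatrix_apply {κ : Type*} (σ : Equiv.Perm β) (T : Matrix κ β ℂ) (i : κ)
    (j : β) : (T * permutationMatrix σ) i j = T i (σ⁻¹ j) := by
  have h : ∀ k, σ k = j ↔ k = σ⁻¹ j := fun k => by rw [Equiv.Perm.eq_inv_iff_eq]
  simp [permutationMatrix, Matrix.mul_apply, h]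

theorem permutationMatrix_mul (σ τ : Equiv.Perm β) :
    permutationMatrix σ * permutationMatrix τ = permutationMatrix (τ * σ) := by
  ext i j
  rw [permutationMatrix_mul_apply]
  rfl

theorem permutationMatrix_mem_unitaryGroup (σ : Equiv.Perm β) :
    permutationMatrix σ ∈ Matrix.unitaryGroup β ℂ := by
  rw [Matrix.mem_unitaryGroup_iff, Matrix.star_eq_conjTranspose, permutationMatrix_conjTranspose,
    permutationMatrix_mul, inv_mul_cancel, permutationMatrix_one]

theorem permutationMatrix_kronecker_mul_apply (σ τ : Equiv.Perm β)
    (T : Matrix (β × β) (β × β) ℂ) (p q : β × β) :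
    ((permutationMatrix σ ⊗ₖ permutationMatrix τ) * T) p q = T (σ p.1, τ p.2) q := by
  rw [permutationMatrix_kronecker, permutationMatrix_mul_apply]
  rfl

theorem mul_permutationMatrix_kronecker_apply (σ τ : Equiv.Perm β)
    (T : Matrix (β × β) (β × β) ℂ) (p q : β × β) :
    (T * (permutationMatrix σ ⊗ₖ permutationMatrix τ)) p q = T p (σ⁻¹ q.1, τ⁻¹ q.2) := by
  rw [permutationMatrix_kronecker, mul_permutationMatrix_apply]
  rfl

/-- A matrix commuting with `U ⊗ conj U` for all unitaries `U` is a combination of the identity and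
of the projection onto the maximally entangled vector. Diagonal unitaries kill all other entries,
permutations make the surviving ones constant, and one unitary mixing two basis vectors relates the
entries `T (a, a) (a, a)` to the others. -/
theorem eq_of_commute_unitary_kronecker_conj [Nontrivial β] {T : Matrix (β × β) (β × β) ℂ}
    (hT : ∀ U ∈ Matrix.unitaryGroup β ℂ, (U ⊗ₖ U.map conj) * T = T * (U ⊗ₖ U.map conj)) :
    ∃ x y : ℂ, ∀ a b c e, T (a, b) (c, e) =
      (if a = c ∧ b = e then x else 0) + (if a = b ∧ c = e then y else 0) := by
  -- Invariance under diagonal unitaries with one entry `I`. An entry `-1` would not do: it equals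
  -- its conjugate and so does not exclude the entries `T (a, b) (b, a)`.
  have hdiag : ∀ j a b c e, (if a = j then Complex.I else 1) * (if b = j then -Complex.I else 1) *
      T (a, b) (c, e) = T (a, b) (c, e) *
        ((if c = j then Complex.I else 1) * (if e = j then -Complex.I else 1)) := by
    intro j a b c e
    have hU : Matrix.diagonal (fun i => if i = j then Complex.I else 1) ∈
        Matrix.unitaryGroup β ℂ := by
      rw [Matrix.mem_unitaryGroup_iff, Matrix.star_eq_conjTranspose, Matrix.diagonal_conjTranspose,
        Matrix.diagonal_mul_diagonal, ← Matrix.diagonal_one]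
      congr 1
      funext i
      by_cases h : i = j <;> simp [h]
    have h := congrFun (congrFun (hT _ hU) (a, b)) (c, e)
    rw [Matrix.diagonal_map (map_zero _), Matrix.diagonal_kronecker_diagonal,
      Matrix.diagonal_mul, Matrix.mul_diagonal] at h
    simpa [apply_ite conj] using h
  have hzero : ∀ a b c e, ¬(a = c ∧ b = e) → ¬(a = b ∧ c = e) → T (a, b) (c, e) = 0 := by
    intro a b c e h1 h2
    by_contra h0
    have key := fun j => mul_left_cancel₀ h0 ((mul_comm _ _).trans (hdiag j a b c e))
    by_cases hac : a = c
    · subst hac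
      have hbe : e ≠ b := fun h => h1 ⟨rfl, h.symm⟩
      have h := key b
      by_cases hab : a = b <;> simp [hab, hbe, Complex.ext_iff] at h
    · by_cases hab : a = b
      · subst hab
        have hce : e ≠ c := fun h => h2 ⟨rfl, h.symm⟩
        have h := key c
        simp [hac, hce, Complex.ext_iff] at h
      · have h := key a
        by_cases hea : e = a <;> simp [Ne.symm hab, Ne.symm hac, hea, Complex.ext_iff] at h
        norm_num at h
  have hperm : ∀ (σ : Equiv.Perm β) a b c e, T (σ a, σ b) (σ c, σ e) = T (a, b) (c, e) := by
    intro σ a b c e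
    have h := congrFun (congrFun (hT _ (permutationMatrix_mem_unitaryGroup σ)) (a, b)) (σ c, σ e)
    rw [permutationMatrix_map_conj, permutationMatrix_kronecker_mul_apply,
      mul_permutationMatrix_kronecker_apply] at h
    simpa using h
  have htrans : ∀ {a c a' c' : β}, a ≠ c → a' ≠ c' → ∃ σ : Equiv.Perm β, σ a = a' ∧ σ c = c' := by
    intro a c a' c' hac hac'
    refine ⟨Equiv.swap (Equiv.swap a a' c) c' * Equiv.swap a a', ?_, ?_⟩
    · have h1 : a' ≠ Equiv.swap a a' c := by
        intro h
        apply hac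
        have := congrArg (Equiv.swap a a') h
        simpa using this
      simp [Equiv.swap_apply_of_ne_of_ne h1 hac']
    · simp
  -- The relation between the three kinds of entries, from the unitary `s + t P` with `P` a
  -- transposition matrix: `|s|² + |t|² = 1` and `s * conj t` is purely imaginary. Since `T`
  -- commutes with `P ⊗ P`, only the commutation with `1 ⊗ P - P ⊗ 1` is new.
  have hrel : ∀ {a c : β}, a ≠ c →
      T (a, a) (a, a) = T (c, a) (c, a) + T (a, a) (c, c) := by
    intro a c hac
    set σ := Equiv.swap a c with hσ
    set P := permutationMatrix σ with hP
    have hPP : P * P = 1 := by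
      rw [hP, permutationMatrix_mul, hσ, Equiv.swap_mul_self, permutationMatrix_one]
    have hPH : Pᴴ = P := by rw [hP, permutationMatrix_conjTranspose, hσ, Equiv.swap_inv]
    set s : ℂ := (1 + Complex.I) / 2 with hs
    set t : ℂ := (1 - Complex.I) / 2 with ht
    have h2 : conj (2 : ℂ) = 2 := Complex.conj_ofNat 2
    have hcs : conj s = t := by simp [hs, ht, sub_eq_add_neg, h2]
    have hct : conj t = s := by simp [hs, ht, h2]
    have hst : s * t = 1 / 2 := by
      rw [hs, ht]; ring_nf; simp; ring
    have hss : s * s = Complex.I / 2 := by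
      rw [hs]; ring_nf; simp
    have htt : t * t = -Complex.I / 2 := by
      rw [ht]; ring_nf; simp
    have hU : s • (1 : Matrix β β ℂ) + t • P ∈ Matrix.unitaryGroup β ℂ := by
      rw [Matrix.mem_unitaryGroup_iff, Matrix.star_eq_conjTranspose, Matrix.conjTranspose_add,
        Matrix.conjTranspose_smul, Matrix.conjTranspose_smul, hPH, Matrix.conjTranspose_one]
      simp only [Matrix.mul_add, Matrix.add_mul, Matrix.smul_mul, Matrix.mul_smul, Matrix.one_mul,
        Matrix.mul_one, hPP, smul_add, smul_smul]
      rw [← starRingEnd_apply, ← starRingEnd_apply, hcs, hct, hst, mul_comm t s, hst, hss, htt]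
      module
    have hK : (s • (1 : Matrix β β ℂ) + t • P) ⊗ₖ (s • (1 : Matrix β β ℂ) + t • P).map conj =
        (1 / 2 : ℂ) • (1 : Matrix (β × β) (β × β) ℂ) + (1 / 2 : ℂ) • (P ⊗ₖ P) +
          (Complex.I / 2) • ((1 : Matrix β β ℂ) ⊗ₖ P) - (Complex.I / 2) • (P ⊗ₖ 1) := by
      have hc : (s • (1 : Matrix β β ℂ) + t • P).map conj = t • (1 : Matrix β β ℂ) + s • P := by
        have h1 := permutationMatrix_map_conj σ
        rw [← hP] at h1
        have h2 : ∀ i j, conj (P i j) = P i j := fun i j => congrFun (congrFun h1 i) j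
        ext i j
        simp [h2, hcs, hct, Matrix.one_apply, apply_ite conj]
      rw [hc]
      simp only [Matrix.add_kronecker, Matrix.kronecker_add, Matrix.smul_kronecker,
        Matrix.kronecker_smul, Matrix.one_kronecker_one, smul_add, smul_smul]
      rw [hst, mul_comm t s, hst, hss, htt]
      module
    have h1 := hT _ hU
    rw [hK] at h1
    have h2 := hT _ (permutationMatrix_mem_unitaryGroup σ)
    rw [permutationMatrix_map_conj, ← hP] at h2
    simp only [Matrix.add_mul, Matrix.sub_mul, Matrix.mul_add, Matrix.mul_sub, Matrix.smul_mul,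
      Matrix.mul_smul, Matrix.one_mul, Matrix.mul_one, h2] at h1
    have h3 := congrFun (congrFun h1 (a, a)) (c, a)
    rw [hP, ← permutationMatrix_one] at h3
    simp only [Matrix.add_apply, Matrix.sub_apply, Matrix.smul_apply,
      permutationMatrix_kronecker_mul_apply, mul_permutationMatrix_kronecker_apply] at h3
    simp [hσ] at h3
    rw [hzero a c c a (by simp [hac]) (by simp [hac])] at h3
    have hI := Complex.I_ne_zero
    have h4 : Complex.I / 2 * (T (a, a) (a, a)) =
        Complex.I / 2 * (T (c, a) (c, a) + T (a, a) (c, c)) := by linear_combination h3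
    exact mul_left_cancel₀ (by simp) h4
  obtain ⟨a₀, c₀, hne⟩ := exists_pair_ne β
  refine ⟨T (a₀, c₀) (a₀, c₀), T (a₀, a₀) (c₀, c₀), fun a b c e => ?_⟩
  have hx : ∀ {a c : β}, a ≠ c → T (a, c) (a, c) = T (a₀, c₀) (a₀, c₀) := by
    intro a c hac
    obtain ⟨σ, rfl, rfl⟩ := htrans hne hac
    exact hperm σ _ _ _ _
  have hy : ∀ {a c : β}, a ≠ c → T (a, a) (c, c) = T (a₀, a₀) (c₀, c₀) := by
    intro a c hac
    obtain ⟨σ, rfl, rfl⟩ := htrans hne hac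
    exact hperm σ _ _ _ _
  by_cases h1 : a = c ∧ b = e
  · obtain ⟨rfl, rfl⟩ := h1
    by_cases hab : a = b
    · subst hab
      obtain ⟨c, hc⟩ := exists_ne a
      simp [hrel hc.symm, hx hc, hy hc.symm]
    · simp [hab, hx hab]
  · by_cases h2 : a = b ∧ c = e
    · obtain ⟨rfl, rfl⟩ := h2
      have hac : a ≠ c := fun h => h1 ⟨h, h⟩
      simp [hac, hy hac]
    · simp [h1, h2, hzero a b c e h1 h2]

end Commutant

/-! ### Trace norm and second moment of the absolute value -/

section TraceNorm

theorem sum_sq_le_sq_sum_of_nonneg {ι : Type*} (s : Finset ι) {f : ι → ℝ}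
    (hf : ∀ i ∈ s, 0 ≤ f i) : ∑ i ∈ s, f i ^ 2 ≤ (∑ i ∈ s, f i) ^ 2 := by
  rw [pow_two (∑ i ∈ s, f i), Finset.sum_mul]
  refine Finset.sum_le_sum fun i hi => ?_
  rw [pow_two]
  exact mul_le_mul_of_nonneg_left (Finset.single_le_sum hf hi) (hf i hi)

theorem toEuclideanLin_mul_apply {α β γ : Type*} [Fintype β] [DecidableEq β] [Fintype γ]
    [DecidableEq γ] (A : Matrix α β ℂ) (B : Matrix β γ ℂ) (x : EuclideanSpace ℂ γ) :
    Matrix.toEuclideanLin (A * B) x = Matrix.toEuclideanLin A (Matrix.toEuclideanLin B x) := by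
  simp [Matrix.toLpLin_apply, Matrix.mulVec_mulVec]

variable {α β : Type*} [Fintype α] [Fintype β] [DecidableEq β]

theorem trace_eq_sum_inner_toEuclideanLin {ι : Type*} [Fintype ι] (A : Matrix β β ℂ)
    (e : OrthonormalBasis ι ℂ (EuclideanSpace ℂ β)) :
    A.trace = ∑ j, inner ℂ (e j) (Matrix.toEuclideanLin A (e j)) := by
  rw [← LinearMap.trace_eq_sum_inner, LinearMap.trace_eq_sum_inner _ (EuclideanSpace.basisFun β ℂ)]
  simp [Matrix.trace, EuclideanSpace.inner_single_left, Matrix.toLpLin_apply]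

open scoped ComplexOrder in
/-- The right singular vectors diagonalize both `GᴴG` and `|G|`. -/
theorem exists_eigenbasis_matrixAbs (G : Matrix α β ℂ) :
    ∃ e : OrthonormalBasis (Fin (Fintype.card β)) ℂ (EuclideanSpace ℂ β), ∀ j,
      Matrix.toEuclideanLin (Gᴴ * G) (e j) = ((matrixSingularValue G j : ℂ) ^ 2) • e j ∧
      Matrix.toEuclideanLin (matrixAbs G) (e j) = (matrixSingularValue G j : ℂ) • e j := by
  classical
  set T := Matrix.toEuclideanLin G with hT
  have hn : Module.finrank ℂ (EuclideanSpace ℂ β) = Fintype.card β := finrank_euclideanSpace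
  set e := T.isSymmetric_adjoint_comp_self.eigenvectorBasis hn with he
  set H := Matrix.toEuclideanLin (matrixAbs G) with hH
  have h1 : ∀ j, Matrix.toEuclideanLin (Gᴴ * G) (e j) =
      ((matrixSingularValue G j : ℂ) ^ 2) • e j := by
    intro j
    rw [toEuclideanLin_mul_apply, Matrix.toEuclideanLin_conjTranspose_eq_adjoint, ← hT,
      ← LinearMap.comp_apply, LinearMap.IsSymmetric.apply_eigenvectorBasis,
      ← T.sq_singularValues_fin hn, matrixSingularValue, ← hT]
    push_cast
    rfl
  refine ⟨e, fun j => ⟨h1 j, ?_⟩⟩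
  have hsymm : ∀ x y, inner ℂ (H x) y = inner ℂ x (H y) :=
    Matrix.isSymmetric_toEuclideanLin_iff.2 (posSemidef_matrixAbs G).isHermitian
  have hpos : ∀ x, 0 ≤ RCLike.re (inner ℂ x (H x)) := fun x => by
    have := (Matrix.isPositive_toEuclideanLin_iff.2
      (posSemidef_matrixAbs G)).re_inner_nonneg_right x
    exact this
  set s := matrixSingularValue G j with hs
  have hHH : H (H (e j)) = ((s : ℂ) ^ 2) • e j := by
    rw [hH, ← toEuclideanLin_mul_apply, matrixAbs_mul_self, h1]
  rcases (matrixSingularValue_nonneg G j).eq_or_lt with h0 | h0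
  · rw [← hs] at h0
    have h2 : inner ℂ (H (e j)) (H (e j)) = 0 := by
      rw [hsymm, hHH, ← h0]; simp
    rw [inner_self_eq_zero.1 h2, ← h0]; simp
  · rw [← hs] at h0
    set w := H (e j) - (s : ℂ) • e j with hw
    have h2 : H w = -((s : ℂ) • w) := by
      rw [hw, map_sub, hHH, map_smul]
      module
    have h3 := hpos w
    rw [h2, inner_neg_right, inner_smul_right, inner_self_eq_norm_sq_to_K] at h3
    have h4 : RCLike.re (-((s : ℂ) * ((‖w‖ : ℂ)) ^ 2)) = -(s * ‖w‖ ^ 2) := by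
      rw [← Complex.ofReal_pow, ← Complex.ofReal_mul, ← Complex.ofReal_neg]
      rfl
    have h5 : 0 ≤ -(s * ‖w‖ ^ 2) := by rw [← h4]; exact h3
    have h6 : ‖w‖ ^ 2 = 0 := by
      have := sq_nonneg ‖w‖
      nlinarith
    have h7 : w = 0 := by simpa using h6
    exact sub_eq_zero.1 h7

theorem schattenNorm_one_eq_sum (G : Matrix α β ℂ) :
    schattenNorm 1 G = ∑ j : Fin (Fintype.card β), matrixSingularValue G j := by
  simp [schattenNorm, Finset.sum_range]

theorem trace_matrixAbs (G : Matrix α β ℂ) : (matrixAbs G).trace = (schattenNorm 1 G : ℂ) := by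
  obtain ⟨e, he⟩ := exists_eigenbasis_matrixAbs G
  rw [trace_eq_sum_inner_toEuclideanLin _ e, schattenNorm_one_eq_sum]
  push_cast
  refine Finset.sum_congr rfl fun j _ => ?_
  rw [(he j).2, inner_smul_right, inner_self_eq_norm_sq_to_K, e.orthonormal.1 j]
  simp

theorem sum_norm_sq_eq_sum_singularValue_sq (G : Matrix α β ℂ) :
    ∑ i, ∑ j, ‖G i j‖ ^ 2 = ∑ j : Fin (Fintype.card β), matrixSingularValue G j ^ 2 := by
  obtain ⟨e, he⟩ := exists_eigenbasis_matrixAbs G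
  have h := sum_norm_sq_eq_trace G
  rw [trace_eq_sum_inner_toEuclideanLin _ e] at h
  have h2 : ∀ j, inner ℂ (e j) (Matrix.toEuclideanLin (Gᴴ * G) (e j)) =
      ((matrixSingularValue G j ^ 2 : ℝ) : ℂ) := fun j => by
    rw [(he j).1, inner_smul_right, inner_self_eq_norm_sq_to_K, e.orthonormal.1 j]
    simp
  simp only [h2] at h
  exact_mod_cast h

theorem sum_norm_sq_le_schattenNorm_one_sq (G : Matrix α β ℂ) :
    ∑ i, ∑ j, ‖G i j‖ ^ 2 ≤ schattenNorm 1 G ^ 2 := by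
  rw [sum_norm_sq_eq_sum_singularValue_sq, schattenNorm_one_eq_sum]
  exact sum_sq_le_sq_sum_of_nonneg _ fun j _ => matrixSingularValue_nonneg G j

theorem sum_norm_sq_matrixAbs (G : Matrix α β ℂ) :
    ∑ a, ∑ c, ‖matrixAbs G a c‖ ^ 2 = ∑ i, ∑ j, ‖G i j‖ ^ 2 := by
  have h : ((∑ a, ∑ c, ‖matrixAbs G a c‖ ^ 2 : ℝ) : ℂ) = (∑ i, ∑ j, ‖G i j‖ ^ 2 : ℝ) := by
    rw [sum_norm_sq_eq_trace, sum_norm_sq_eq_trace, isHermitian_matrixAbs, matrixAbs_mul_self]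
  exact_mod_cast h

theorem norm_matrixAbs_entry_le (G : Matrix α β ℂ) (a c : β) :
    ‖matrixAbs G a c‖ ≤ ∑ i, ∑ j, ‖G i j‖ := by
  have h1 : ‖matrixAbs G a c‖ ^ 2 ≤ ∑ i, ∑ j, ‖G i j‖ ^ 2 := by
    rw [← sum_norm_sq_matrixAbs]
    exact (Finset.single_le_sum (f := fun c => ‖matrixAbs G a c‖ ^ 2) (fun _ _ => by positivity)
      (Finset.mem_univ c)).trans (Finset.single_le_sum
      (f := fun a => ∑ c, ‖matrixAbs G a c‖ ^ 2) (fun _ _ => by positivity) (Finset.mem_univ a))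
  refine (pow_le_pow_iff_left₀ (norm_nonneg _) (by positivity) two_ne_zero).1 (h1.trans ?_)
  rw [← Fintype.sum_prod_type' (fun i j => ‖G i j‖ ^ 2), ← Fintype.sum_prod_type'
    (fun i j => ‖G i j‖)]
  exact sum_sq_le_sq_sum_of_nonneg _ fun j _ => norm_nonneg _

end TraceNorm

section Moments
variable {α β : Type*} [Fintype α] [Fintype β]

theorem integral_sum_norm_sq_gaussianMatrix (v : ℝ≥0) :
    ∫ G, ∑ i, ∑ j, ‖G i j‖ ^ 2 ∂(gaussianMatrix α β v) =
      Fintype.card α * Fintype.card β * v := by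
  have hi : ∀ i j, Integrable (fun G : Matrix α β ℂ => ‖G i j‖ ^ 2) (gaussianMatrix α β v) :=
    fun i j => (memLp_entry_gaussianMatrix v (p := 2) (by simp) i j).integrable_norm_pow two_ne_zero
  rw [integral_finsetSum _ fun i _ => integrable_finsetSum _ fun j _ => hi i j]
  simp only [integral_finsetSum _ fun j _ => hi _ j, integral_norm_sq_entry_gaussianMatrix]
  simp [mul_assoc]

variable [DecidableEq β]

theorem memLp_matrixAbs_entry (v : ℝ≥0) {p : ℝ≥0∞} (hp : p ≠ ∞) (a c : β) :
    MemLp (fun G : Matrix α β ℂ => matrixAbs G a c) p (gaussianMatrix α β v) := by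
  have h : MemLp (fun G : Matrix α β ℂ => ∑ i, ∑ j, ‖G i j‖) p (gaussianMatrix α β v) :=
    memLp_finsetSum _ fun i _ => memLp_finsetSum _ fun j _ =>
      (memLp_entry_gaussianMatrix v hp i j).norm
  refine h.of_le ((measurable_entry a c).comp measurable_matrixAbs).aestronglyMeasurable ?_
  refine Filter.Eventually.of_forall fun G => ?_
  exact (norm_matrixAbs_entry_le G a c).trans (le_abs_self _)

theorem integrable_mul_conj_of_memLp {Ω : Type*} [MeasurableSpace Ω] {μ : Measure Ω} {f g : Ω → ℂ}
    (hf : MemLp f 2 μ) (hg : MemLp g 2 μ) : Integrable (fun x => f x * conj (g x)) μ :=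
  hf.integrable_mul hg.star

theorem integral_matrix_mul_mul {Ω m n l r : Type*} [Fintype n] [Fintype l]
    [MeasurableSpace Ω] {μ : Measure Ω} (A : Matrix m n ℂ) (B : Matrix l r ℂ)
    {X : Ω → Matrix n l ℂ} (hX : ∀ i j, Integrable (fun ω => X ω i j) μ) (i : m) (j : r) :
    Integrable (fun ω => (A * X ω * B) i j) μ ∧
      ∫ ω, (A * X ω * B) i j ∂μ = (A * (Matrix.of fun i j => ∫ ω, X ω i j ∂μ) * B) i j := by
  have h : ∀ M : Matrix n l ℂ, (A * M * B) i j = ∑ y, ∑ x, A i x * M x y * B y j := fun M => by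
    simp only [Matrix.mul_apply, Finset.sum_mul]
  simp only [h]
  have hi : ∀ x y, Integrable (fun ω => A i x * X ω x y * B y j) μ := fun x y =>
    ((hX x y).const_mul _).mul_const _
  refine ⟨integrable_finsetSum _ fun y _ => integrable_finsetSum _ fun x _ => hi x y, ?_⟩
  rw [integral_finsetSum _ fun y _ => integrable_finsetSum _ fun x _ => hi x y]
  refine Finset.sum_congr rfl fun y _ => ?_
  rw [integral_finsetSum _ fun x _ => hi x y]
  refine Finset.sum_congr rfl fun x _ => ?_
  rw [integral_mul_const, integral_const_mul, Matrix.of_apply]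

/-- The matrix `𝔼 (|G| ⊗ conj |G|)`. -/
def absMoment (α β : Type*) [Fintype α] [Fintype β] [DecidableEq β] (v : ℝ≥0) :
    Matrix (β × β) (β × β) ℂ :=
  Matrix.of fun p q => ∫ G, (matrixAbs G ⊗ₖ (matrixAbs G).map conj) p q ∂(gaussianMatrix α β v)

theorem integrable_matrixAbs_kronecker (v : ℝ≥0) (p q : β × β) :
    Integrable (fun G => (matrixAbs G ⊗ₖ (matrixAbs G).map conj) p q) (gaussianMatrix α β v) :=
  integrable_mul_conj_of_memLp (memLp_matrixAbs_entry v (by simp) _ _)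
    (memLp_matrixAbs_entry v (by simp) _ _)

theorem absMoment_commute (v : ℝ≥0) {U : Matrix β β ℂ} (hU : U ∈ Matrix.unitaryGroup β ℂ) :
    (U ⊗ₖ U.map conj) * absMoment α β v = absMoment α β v * (U ⊗ₖ U.map conj) := by
  set K := U ⊗ₖ U.map conj with hK
  have hUU : U * Uᴴ = 1 := Matrix.mem_unitaryGroup_iff.1 hU
  have hmapmul : ∀ A B : Matrix β β ℂ, (A * B).map conj = A.map conj * B.map conj := fun A B =>
    Matrix.map_mul
  have hKK : K * Kᴴ = 1 := by
    have h2 : U.map conj * (U.map conj)ᴴ = 1 := by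
      have : (U.map conj)ᴴ = (Uᴴ).map conj := by ext; simp
      rw [this, ← hmapmul, hUU]
      ext i j
      simp [Matrix.one_apply, apply_ite conj]
    rw [hK, Matrix.conjTranspose_kronecker, ← Matrix.mul_kronecker_mul, hUU, h2,
      Matrix.one_kronecker_one]
  have hinv : absMoment α β v = Kᴴ * absMoment α β v * K := by
    ext p q
    have hm : Measurable fun G : Matrix α β ℂ => G * U := by
      have : Continuous fun G : Matrix α β ℂ => G * U := by fun_prop
      exact this.measurable
    have h1 := (integral_matrix_mul_mul Kᴴ K
      (fun p q => integrable_matrixAbs_kronecker (α := α) v p q) p q).2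
    refine Eq.trans ?_ h1
    rw [absMoment, Matrix.of_apply]
    conv_lhs => rw [← gaussianMatrix_map_mul_right v hU]
    rw [integral_map hm.aemeasurable]
    · congr 1 with G
      rw [matrixAbs_mul_unitary G hU, hmapmul, hmapmul, Matrix.mul_kronecker_mul,
        Matrix.mul_kronecker_mul, hK, Matrix.conjTranspose_kronecker]
      congr 3
    · exact (((measurable_entry p.1 q.1).comp measurable_matrixAbs).mul (measurable_conj.comp
        ((measurable_entry p.2 q.2).comp measurable_matrixAbs))).aestronglyMeasurable
  conv_lhs => rw [hinv]
  rw [← Matrix.mul_assoc, ← Matrix.mul_assoc, hKK, Matrix.one_mul]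

/-- Identification of the coefficient of the identity in `𝔼 (|G| ⊗ conj |G|)`, from the two linear
equations given by `𝔼 ‖G‖₁²` and `𝔼 ‖G‖₂² = card β`. -/
theorem absMoment_eq [Nontrivial β] (v : ℝ≥0)
    (hv : (Fintype.card α : ℝ) * v = 1) :
    ∃ y : ℂ, ∀ a b c e, absMoment α β v (a, b) (c, e) =
      (if a = c ∧ b = e then
        ((((∫ G, schattenNorm 1 G ^ 2 ∂(gaussianMatrix α β v)) - 1) /
          ((Fintype.card β : ℝ) ^ 2 - 1) : ℝ) : ℂ) else 0) + (if a = b ∧ c = e then y else 0) := by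
  obtain ⟨x, y, hxy⟩ := eq_of_commute_unitary_kronecker_conj (T := absMoment α β v)
    fun U hU => absMoment_commute v hU
  refine ⟨y, ?_⟩
  set D : ℝ := (Fintype.card β : ℝ) with hD
  set E := ∫ G, schattenNorm 1 G ^ 2 ∂(gaussianMatrix α β v) with hE
  have hD1 : 1 < D := by rw [hD]; exact_mod_cast Fintype.one_lt_card
  have h1 : ∑ a, ∑ b, absMoment α β v (a, b) (a, b) = (E : ℂ) := by
    have hs : ∀ G : Matrix α β ℂ, ∑ a, ∑ b, (matrixAbs G ⊗ₖ (matrixAbs G).map conj) (a, b) (a, b) =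
        ((schattenNorm 1 G ^ 2 : ℝ) : ℂ) := by
      intro G
      simp only [Matrix.kroneckerMap_apply, Matrix.map_apply]
      rw [← Finset.sum_mul_sum, ← map_sum]
      have : ∑ a, matrixAbs G a a = (schattenNorm 1 G : ℂ) := trace_matrixAbs G
      rw [this, Complex.conj_ofReal]
      push_cast; ring
    rw [hE, ← integral_complex_ofReal]
    simp only [← hs]
    rw [integral_finsetSum _ fun a _ => integrable_finsetSum _ fun b _ =>
      integrable_matrixAbs_kronecker v _ _]
    simp only [integral_finsetSum _ fun b _ => integrable_matrixAbs_kronecker v (_, b) (_, b)]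
    rfl
  have h2 : ∑ a, ∑ c, absMoment α β v (a, a) (c, c) = (D : ℂ) := by
    have hs : ∀ G : Matrix α β ℂ, ∑ a, ∑ c, (matrixAbs G ⊗ₖ (matrixAbs G).map conj) (a, a) (c, c) =
        ((∑ i, ∑ j, ‖G i j‖ ^ 2 : ℝ) : ℂ) := by
      intro G
      rw [← sum_norm_sq_matrixAbs]
      simp only [Matrix.kroneckerMap_apply, Matrix.map_apply, Complex.mul_conj']
      push_cast; rfl
    have hI : D = ∫ G, ∑ i, ∑ j, ‖G i j‖ ^ 2 ∂(gaussianMatrix α β v) := by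
      rw [integral_sum_norm_sq_gaussianMatrix, hD]
      linear_combination (-(Fintype.card β : ℝ)) * hv
    rw [hI, ← integral_complex_ofReal]
    simp only [← hs]
    rw [integral_finsetSum _ fun a _ => integrable_finsetSum _ fun b _ =>
      integrable_matrixAbs_kronecker v _ _]
    simp only [integral_finsetSum _ fun b _ => integrable_matrixAbs_kronecker v (_, _) (b, b)]
    rfl
  simp only [hxy, Finset.sum_add_distrib] at h1 h2
  have h3 : x * D ^ 2 + y * D = E := by
    refine Eq.trans ?_ h1
    simp [hD, pow_two]
    ring
  have h4 : x * D + y * D ^ 2 = D := by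
    refine Eq.trans ?_ h2
    simp [hD, pow_two]
    ring
  have hx : x = (((E - 1) / (D ^ 2 - 1) : ℝ) : ℂ) := by
    have hD0 : (D : ℂ) ≠ 0 := by exact_mod_cast (by linarith : D ≠ 0)
    have hD2 : ((D : ℂ) ^ 2 - 1) ≠ 0 := by
      have : D ^ 2 - 1 ≠ 0 := by nlinarith
      exact_mod_cast this
    have h5 : x + y * D = 1 := mul_left_cancel₀ hD0 (by linear_combination h4)
    push_cast
    rw [eq_div_iff hD2]
    linear_combination h3 - h5
  intro a b c e
  rw [hxy, hx]

/-- The trace norm dominates the Hilbert–Schmidt norm, whose second moment is `card β`. -/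
theorem card_le_integral_schattenNorm_one_sq (v : ℝ≥0) (hv : (Fintype.card α : ℝ) * v = 1) :
    (Fintype.card β : ℝ) ≤ ∫ G, schattenNorm 1 G ^ 2 ∂(gaussianMatrix α β v) := by
  have h : (Fintype.card β : ℝ) = ∫ G, ∑ i, ∑ j, ‖G i j‖ ^ 2 ∂(gaussianMatrix α β v) := by
    rw [integral_sum_norm_sq_gaussianMatrix]
    linear_combination (-(Fintype.card β : ℝ)) * hv
  rw [h]
  have hi : ∀ i j, Integrable (fun G : Matrix α β ℂ => ‖G i j‖ ^ 2) (gaussianMatrix α β v) :=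
    fun i j => (memLp_entry_gaussianMatrix v (p := 2) (by simp) i j).integrable_norm_pow two_ne_zero
  have : Fact ((1 : ℝ≥0∞) ≤ 1) := ⟨le_rfl⟩
  refine integral_mono (integrable_finsetSum _ fun i _ => integrable_finsetSum _ fun j _ => hi i j)
    ?_ fun G => sum_norm_sq_le_schattenNorm_one_sq G
  exact (memLp_schattenNorm 1 fun i j =>
    memLp_entry_gaussianMatrix v (p := 2) (by simp) i j).integrable_sq

end Moments

/-! ### The maximally entangled state and `χ` -/

section MaxEnt

theorem maxEnt_apply (d : ℕ) (p q : Fin d × Fin d) :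
    maxEnt d p q = if p.1 = p.2 ∧ q.1 = q.2 then (d : ℂ)⁻¹ else 0 := by
  have h : ((1 / Real.sqrt d : ℝ) : ℂ) * ((1 / Real.sqrt d : ℝ) : ℂ) = (d : ℂ)⁻¹ := by
    rw [← Complex.ofReal_mul, div_mul_div_comm, Real.mul_self_sqrt (by positivity)]
    push_cast
    ring
  by_cases hp : p.1 = p.2 <;> by_cases hq : q.1 = q.2 <;>
    simp [maxEnt, maxEntVec, Matrix.vecMulVec_apply, hp, hq]
  rw [← h]; push_cast; ring

/-- Matrices all of whose rows are multiples of `Ω_d^*` are annihilated by `1 - ω_d`. -/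
theorem mul_one_sub_maxEnt_of_rows {d : ℕ} (hd : d ≠ 0) {ι : Type*} (m : ι → ℂ) :
    (Matrix.of fun p (q : Fin d × Fin d) => if q.1 = q.2 then m p else 0) * (1 - maxEnt d) = 0 := by
  have hd' : (d : ℂ) ≠ 0 := by exact_mod_cast hd
  rw [Matrix.mul_sub, Matrix.mul_one, sub_eq_zero]
  ext p q
  simp only [Matrix.mul_apply, Matrix.of_apply, maxEnt_apply, Fintype.sum_prod_type]
  by_cases hq : q.1 = q.2
  · simp [hq]
    rw [mul_left_comm, mul_inv_cancel₀ hd', mul_one]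
  · simp [hq]

theorem isHermitian_one_sub_maxEnt (d : ℕ) : (1 - maxEnt d).IsHermitian := by
  refine Matrix.isHermitian_one.sub ?_
  ext p q
  simp only [Matrix.conjTranspose_apply, maxEnt_apply]
  by_cases hp : p.1 = p.2 <;> by_cases hq : q.1 = q.2 <;> simp [hp, hq]

theorem one_sub_maxEnt_mul_self {d : ℕ} (hd : d ≠ 0) :
    (1 - maxEnt d) * (1 - maxEnt d) = 1 - maxEnt d := by
  have h : maxEnt d * (1 - maxEnt d) = 0 := by
    rw [← mul_one_sub_maxEnt_of_rows hd fun p : Fin d × Fin d => if p.1 = p.2 then (d : ℂ)⁻¹ else 0]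
    congr 1
    ext p q
    rw [maxEnt_apply, Matrix.of_apply]
    by_cases hp : p.1 = p.2 <;> by_cases hq : q.1 = q.2 <;> simp [hp, hq]
  rw [Matrix.sub_mul, h, Matrix.one_mul, sub_zero]

/-- The defining expectation of `χ`, taken over matrices with rows indexed by `Fin n × Fin k`. -/
theorem chi_eq (n k d : ℕ) :
    chi (n * k) d = ((∫ G, schattenNorm 1 G ^ 2
      ∂(gaussianMatrix (Fin n × Fin k) (Fin d) ((n * k : ℕ) : ℝ≥0)⁻¹)) - 1) /
        ((Fintype.card (Fin d) : ℝ) ^ 2 - 1) := by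
  have : Fact ((1 : ℝ≥0∞) ≤ 1) := ⟨le_rfl⟩
  rw [chi, ginibre_eq_gaussianMatrix, Fintype.card_fin,
    ← gaussianMatrix_map_reindex _ (finProdFinEquiv (m := n) (n := k)), integral_map]
  · congr 3
    funext G
    have h : ∀ G : Matrix (Fin n × Fin k) (Fin d) ℂ,
        schattenNorm 1 (G.submatrix finProdFinEquiv.symm id) = schattenNorm 1 G := by
      intro G
      have h1 : matrixAbs (G.submatrix finProdFinEquiv.symm id) = matrixAbs G := by
        refine matrixAbs_eq_of_mul_self (posSemidef_matrixAbs G) ?_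
        rw [matrixAbs_mul_self, Matrix.conjTranspose_submatrix,
          Matrix.submatrix_mul_equiv, Matrix.submatrix_id_id]
      have h2 := trace_matrixAbs (G.submatrix finProdFinEquiv.symm id)
      rw [h1, trace_matrixAbs] at h2
      exact_mod_cast h2.symm
    rw [h]
  · exact (measurable_matrix fun i j => measurable_entry _ _).aemeasurable
  · exact ((measurable_schattenNorm 1).pow_const 2).aestronglyMeasurable

theorem chi_pos {n k d : ℕ} (hd : 2 ≤ d) (hnk : n * k ≠ 0) : 0 < chi (n * k) d := by
  rw [chi_eq]
  have h := card_le_integral_schattenNorm_one_sq (α := Fin n × Fin k) (β := Fin d)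
    ((n * k : ℕ) : ℝ≥0)⁻¹ (by
      have : ((n * k : ℕ) : ℝ) ≠ 0 := by exact_mod_cast hnk
      rw [Fintype.card_prod, Fintype.card_fin, Fintype.card_fin]
      simp only [NNReal.coe_inv, NNReal.coe_natCast]
      exact mul_inv_cancel₀ this)
  rw [Fintype.card_fin] at h ⊢
  have hd' : (2 : ℝ) ≤ d := by exact_mod_cast hd
  exact div_pos (by linarith) (by nlinarith)

theorem absMoment_mul_one_sub_maxEnt {n k d : ℕ} (hd : 2 ≤ d) (hnk : n * k ≠ 0) :
    absMoment (Fin n × Fin k) (Fin d) ((n * k : ℕ) : ℝ≥0)⁻¹ * (1 - maxEnt d) =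
      (chi (n * k) d : ℂ) • (1 - maxEnt d) := by
  have : Nontrivial (Fin d) := Fin.nontrivial_iff_two_le.2 hd
  obtain ⟨y, hy⟩ := absMoment_eq (α := Fin n × Fin k) (β := Fin d)
    ((n * k : ℕ) : ℝ≥0)⁻¹ (by
      have : ((n * k : ℕ) : ℝ) ≠ 0 := by exact_mod_cast hnk
      rw [Fintype.card_prod, Fintype.card_fin, Fintype.card_fin]
      simp only [NNReal.coe_inv, NNReal.coe_natCast]
      exact mul_inv_cancel₀ this)
  rw [← chi_eq] at hy
  have h : absMoment (Fin n × Fin k) (Fin d) ((n * k : ℕ) : ℝ≥0)⁻¹ =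
      (chi (n * k) d : ℂ) • 1 + Matrix.of fun p (q : Fin d × Fin d) =>
        if q.1 = q.2 then (if p.1 = p.2 then y else 0) else 0 := by
    ext ⟨a, b⟩ ⟨c, e⟩
    rw [hy]
    simp only [Matrix.add_apply, Matrix.smul_apply, Matrix.one_apply, Matrix.of_apply,
      Prod.mk.injEq, smul_eq_mul]
    by_cases h1 : a = b <;> by_cases h2 : c = e <;> simp [h1, h2]
  rw [h, Matrix.add_mul, mul_one_sub_maxEnt_of_rows (by omega), add_zero, Matrix.smul_mul,
    Matrix.one_mul]

end MaxEnt

/-! ### The super-operator as a sesquilinear form -/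

section Kraus
variable {n k d : ℕ}

/-- The form `∑ i, A_i ⊗ conj B_i`, linear in `A` and conjugate-linear in `B`, whose diagonal values
are the super-operators. -/
def krausPairing (A B : Matrix (Fin n × Fin k) (Fin d) ℂ) :
    Matrix (Fin n × Fin n) (Fin d × Fin d) ℂ :=
  ∑ i : Fin k, krausOp A i ⊗ₖ (krausOp B i).map conj

theorem superOp_eq_krausPairing (A : Matrix (Fin n × Fin k) (Fin d) ℂ) :
    superOp A = krausPairing A A := rfl

theorem krausPairing_apply (A B : Matrix (Fin n × Fin k) (Fin d) ℂ) (p : Fin n × Fin n)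
    (q : Fin d × Fin d) :
    krausPairing A B p q = ∑ i, A (p.1, i) q.1 * conj (B (p.2, i) q.2) := by
  simp [krausPairing, krausOp, Matrix.sum_apply]

theorem superOp_mul (V : Matrix (Fin n × Fin k) (Fin d) ℂ) (H : Matrix (Fin d) (Fin d) ℂ) :
    superOp (V * H) = superOp V * (H ⊗ₖ H.map conj) := by
  have h : ∀ i, krausOp (V * H) i = krausOp V i * H := fun i => by
    ext a b; simp [krausOp, Matrix.mul_apply]
  simp only [superOp, h, Matrix.sum_mul]
  refine Finset.sum_congr rfl fun i _ => ?_
  rw [← Matrix.mul_kronecker_mul, Matrix.map_mul]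

theorem superOp_rotation (A B : Matrix (Fin n × Fin k) (Fin d) ℂ) :
    superOp (((√2)⁻¹ : ℝ) • (A + B)) - superOp (((√2)⁻¹ : ℝ) • (A - B)) =
      krausPairing A B + krausPairing B A := by
  ext p q
  have h2 : (((√2)⁻¹ : ℝ) : ℂ) * (((√2)⁻¹ : ℝ) : ℂ) = 1 / 2 := by
    rw [← Complex.ofReal_mul, ← mul_inv, Real.mul_self_sqrt (by norm_num)]
    norm_num
  simp only [superOp_eq_krausPairing, Matrix.sub_apply, Matrix.add_apply, krausPairing_apply,
    Matrix.smul_apply, Complex.real_smul, map_mul, map_add, map_sub, Complex.conj_ofReal]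
  rw [← Finset.sum_sub_distrib, ← Finset.sum_add_distrib]
  refine Finset.sum_congr rfl fun i _ => ?_
  linear_combination (2 * (A (p.1, i) q.1 * conj (B (p.2, i) q.2)) +
    2 * (B (p.1, i) q.1 * conj (A (p.2, i) q.2))) * h2

theorem continuous_krausPairing : Continuous fun z : Matrix (Fin n × Fin k) (Fin d) ℂ ×
    Matrix (Fin n × Fin k) (Fin d) ℂ => krausPairing z.1 z.2 := by
  refine continuous_matrix fun p q => ?_
  simp only [krausPairing_apply]
  refine continuous_finsetSum _ fun i _ => ?_
  exact (continuous_fst.matrix_elem _ _).mul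
    (Complex.continuous_conj.comp (continuous_snd.matrix_elem _ _))

theorem continuous_superOp : Continuous fun A : Matrix (Fin n × Fin k) (Fin d) ℂ => superOp A :=
  continuous_krausPairing.comp (continuous_id.prodMk continuous_id)

theorem integrable_superOp_gaussianMatrix (v : ℝ≥0) (p : Fin n × Fin n) (q : Fin d × Fin d) :
    Integrable (fun G => superOp G p q) (gaussianMatrix (Fin n × Fin k) (Fin d) v) := by
  simp only [superOp_eq_krausPairing, krausPairing_apply]
  exact integrable_finsetSum _ fun i _ => integrable_mul_conj_of_memLp
    (memLp_entry_gaussianMatrix v (by simp) _ _) (memLp_entry_gaussianMatrix v (by simp) _ _)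

/-- The expected super-operator of a Gaussian matrix is proportional to `Ω_n Ω_d^*`. -/
theorem integral_superOp_gaussianMatrix (v : ℝ≥0) :
    (Matrix.of fun p q => ∫ G, superOp G p q ∂(gaussianMatrix (Fin n × Fin k) (Fin d) v)) =
      Matrix.of fun p (q : Fin d × Fin d) =>
        if q.1 = q.2 then (if p.1 = p.2 then (k : ℂ) * v else 0) else 0 := by
  ext p q
  simp only [superOp_eq_krausPairing, krausPairing_apply, Matrix.of_apply]
  rw [integral_finsetSum _ fun i _ => integrable_mul_conj_of_memLp
    (memLp_entry_gaussianMatrix v (by simp) _ _) (memLp_entry_gaussianMatrix v (by simp) _ _)]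
  have h : ∀ i : Fin k, ∫ G, G (p.1, i) q.1 * conj (G (p.2, i) q.2)
      ∂(gaussianMatrix (Fin n × Fin k) (Fin d) v) =
      if ((p.1, i), q.1) = ((p.2, i), q.2) then (v : ℂ) else 0 := fun i =>
    integral_mul_conj_gaussianMatrix v ((p.1, i), q.1) ((p.2, i), q.2)
  simp only [h]
  by_cases h1 : p.1 = p.2 <;> by_cases h2 : q.1 = q.2 <;> simp [h1, h2]

end Kraus

/-! ### Comparison and decoupling -/

section Chain
variable {n k d : ℕ}

/-- Comparison of the Haar isometry with a Gaussian matrix: `χ F(V) (1 - ω_d)` is the average of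
`F(V |G|) (1 - ω_d)` over `G`. -/
theorem eLpNorm_superOp_isometry_le (hd : 2 ≤ d) (hnk : n * k ≠ 0)
    {ν : Measure (Matrix (Fin n × Fin k) (Fin d) ℂ)} (hν : IsHaarIsometryLaw ν)
    {p : ℝ≥0∞} (hp : 1 ≤ p) (hp' : p ≠ ∞) (q : ℝ≥0∞) [Fact (1 ≤ q)] :
    ENNReal.ofReal (chi (n * k) d) *
      eLpNorm (fun V => schattenNorm q (superOp V * (1 - maxEnt d))) p ν ≤
      eLpNorm (fun G => schattenNorm q (superOp G * (1 - maxEnt d))) p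
        (gaussianMatrix (Fin n × Fin k) (Fin d) ((n * k : ℕ) : ℝ≥0)⁻¹) := by
  have := hν.isProbabilityMeasure
  set v : ℝ≥0 := ((n * k : ℕ) : ℝ≥0)⁻¹ with hv
  set γ := gaussianMatrix (Fin n × Fin k) (Fin d) v with hγ
  have hχ := chi_pos hd hnk
  have hcont : Continuous fun V : Matrix (Fin n × Fin k) (Fin d) ℂ =>
      superOp V * (1 - maxEnt d) := continuous_superOp.matrix_mul continuous_const
  have hmul : Measurable fun z : Matrix (Fin n × Fin k) (Fin d) ℂ ×
      Matrix (Fin n × Fin k) (Fin d) ℂ => z.1 * matrixAbs z.2 := by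
    have : Continuous fun z : Matrix (Fin n × Fin k) (Fin d) ℂ × Matrix (Fin d) (Fin d) ℂ =>
      z.1 * z.2 := by fun_prop
    exact this.measurable.comp
      (measurable_fst.prodMk (measurable_matrixAbs.comp measurable_snd))
  have hJ := eLpNorm_schattenNorm_integral_le (μ := ν) (π := γ) hp hp' q
    (X := fun V G => superOp (V * matrixAbs G) * (1 - maxEnt d))
    (M := fun V => (chi (n * k) d : ℂ) • (superOp V * (1 - maxEnt d)))
    (hcont.measurable.comp hmul)
    (Filter.Eventually.of_forall fun V i j => by
      simp only [superOp_mul]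
      exact (integral_matrix_mul_mul (superOp V) (1 - maxEnt d)
        (fun a b => integrable_matrixAbs_kronecker (α := Fin n × Fin k) v a b) i j).1)
    (Filter.Eventually.of_forall fun V i j => by
      simp only [superOp_mul]
      rw [(integral_matrix_mul_mul (superOp V) (1 - maxEnt d)
        (fun a b => integrable_matrixAbs_kronecker (α := Fin n × Fin k) v a b) i j).2]
      have h : superOp V * absMoment (Fin n × Fin k) (Fin d) v * (1 - maxEnt d) =
          (chi (n * k) d : ℂ) • (superOp V * (1 - maxEnt d)) := by
        rw [Matrix.mul_assoc, absMoment_mul_one_sub_maxEnt hd hnk, Matrix.mul_smul]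
      exact (congrFun (congrFun h i) j).symm)
  have hleft : (fun V : Matrix (Fin n × Fin k) (Fin d) ℂ =>
      schattenNorm q ((chi (n * k) d : ℂ) • (superOp V * (1 - maxEnt d)))) =
      chi (n * k) d • fun V => schattenNorm q (superOp V * (1 - maxEnt d)) := by
    funext V
    rw [schattenNorm_smul, Complex.norm_real, Real.norm_of_nonneg hχ.le]
    rfl
  rw [hleft, eLpNorm_const_smul, Real.enorm_of_nonneg hχ.le] at hJ
  refine hJ.trans_eq ?_
  conv_rhs => rw [hγ, ← map_isometry_mul_matrixAbs v hν.isometry hν.map_mul_left]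
  have hN : Measurable fun V : Matrix (Fin n × Fin k) (Fin d) ℂ =>
    schattenNorm q (superOp V * (1 - maxEnt d)) := (measurable_schattenNorm q).comp hcont.measurable
  rw [eLpNorm_map_measure hN.aestronglyMeasurable hmul.aemeasurable]
  rfl

/-- Decoupling: the two matrices on the right are independent. -/
theorem eLpNorm_superOp_gaussianMatrix_le (hd : d ≠ 0) (v : ℝ≥0)
    {p : ℝ≥0∞} (hp : 1 ≤ p) (hp' : p ≠ ∞) (q : ℝ≥0∞) [Fact (1 ≤ q)] :
    eLpNorm (fun G => schattenNorm q (superOp G * (1 - maxEnt d))) p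
        (gaussianMatrix (Fin n × Fin k) (Fin d) v) ≤
      2 * eLpNorm (fun z : Matrix (Fin n × Fin k) (Fin d) ℂ × Matrix (Fin n × Fin k) (Fin d) ℂ =>
        schattenNorm q (krausPairing z.1 z.2)) p
        ((gaussianMatrix (Fin n × Fin k) (Fin d) v).prod
          (gaussianMatrix (Fin n × Fin k) (Fin d) v)) := by
  set γ := gaussianMatrix (Fin n × Fin k) (Fin d) v with hγ
  have hcontd : Continuous fun z : Matrix (Fin n × Fin k) (Fin d) ℂ ×
      Matrix (Fin n × Fin k) (Fin d) ℂ => superOp z.1 - superOp z.2 :=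
    (continuous_superOp.comp continuous_fst).sub (continuous_superOp.comp continuous_snd)
  have hcont : Continuous fun z : Matrix (Fin n × Fin k) (Fin d) ℂ ×
      Matrix (Fin n × Fin k) (Fin d) ℂ => (superOp z.1 - superOp z.2) * (1 - maxEnt d) :=
    hcontd.matrix_mul continuous_const
  have hX : ∀ (G : Matrix (Fin n × Fin k) (Fin d) ℂ) a b,
      Integrable (fun G' => (superOp G - superOp G') a b) γ := fun G a b =>
    (integrable_const _).sub (integrable_superOp_gaussianMatrix v a b)
  have hEX : ∀ G : Matrix (Fin n × Fin k) (Fin d) ℂ,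
      (Matrix.of fun a b => ∫ G', (superOp G - superOp G') a b ∂γ) * (1 - maxEnt d) =
        superOp G * (1 - maxEnt d) := by
    intro G
    have : (Matrix.of fun a b => ∫ G', (superOp G - superOp G') a b ∂γ) =
        superOp G - Matrix.of fun a b => ∫ G', superOp G' a b ∂γ := by
      ext a b
      simp only [Matrix.of_apply, Matrix.sub_apply]
      rw [integral_sub (integrable_const _) (integrable_superOp_gaussianMatrix v a b)]
      simp [hγ]
    rw [this, hγ, integral_superOp_gaussianMatrix, Matrix.sub_mul, mul_one_sub_maxEnt_of_rows hd,
      sub_zero]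
  have hJ := eLpNorm_schattenNorm_integral_le (μ := γ) (π := γ) hp hp' q
    (X := fun G G' => (superOp G - superOp G') * (1 - maxEnt d))
    (M := fun G => superOp G * (1 - maxEnt d)) hcont.measurable
    (Filter.Eventually.of_forall fun G i j => by
      have := (integral_matrix_mul_mul (1 : Matrix (Fin n × Fin n) (Fin n × Fin n) ℂ)
        (1 - maxEnt d) (hX G) i j).1
      simpa only [Matrix.one_mul] using this)
    (Filter.Eventually.of_forall fun G i j => by
      have := (integral_matrix_mul_mul (1 : Matrix (Fin n × Fin n) (Fin n × Fin n) ℂ)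
        (1 - maxEnt d) (hX G) i j).2
      simp only [Matrix.one_mul] at this
      rw [this, hEX])
  have hrot : Continuous fun z : Matrix (Fin n × Fin k) (Fin d) ℂ ×
      Matrix (Fin n × Fin k) (Fin d) ℂ =>
      (((√2)⁻¹ : ℝ) • (z.1 + z.2), ((√2)⁻¹ : ℝ) • (z.1 - z.2)) := by fun_prop
  have hF : Measurable fun z : Matrix (Fin n × Fin k) (Fin d) ℂ ×
      Matrix (Fin n × Fin k) (Fin d) ℂ => schattenNorm q (krausPairing z.1 z.2) :=
    (measurable_schattenNorm q).comp continuous_krausPairing.measurable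
  calc eLpNorm (fun G => schattenNorm q (superOp G * (1 - maxEnt d))) p γ
      ≤ eLpNorm (fun z : Matrix (Fin n × Fin k) (Fin d) ℂ × Matrix (Fin n × Fin k) (Fin d) ℂ =>
          schattenNorm q ((superOp z.1 - superOp z.2) * (1 - maxEnt d))) p (γ.prod γ) := hJ
    _ ≤ eLpNorm (fun z : Matrix (Fin n × Fin k) (Fin d) ℂ × Matrix (Fin n × Fin k) (Fin d) ℂ =>
          schattenNorm q (superOp z.1 - superOp z.2)) p (γ.prod γ) := by
        refine eLpNorm_mono_real fun z => ?_
        rw [Real.norm_of_nonneg (schattenNorm_nonneg q _)]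
        exact schattenNorm_mul_projection_le q _ (isHermitian_one_sub_maxEnt d)
          (one_sub_maxEnt_mul_self hd)
    _ = eLpNorm (fun z : Matrix (Fin n × Fin k) (Fin d) ℂ × Matrix (Fin n × Fin k) (Fin d) ℂ =>
          schattenNorm q (krausPairing z.1 z.2 + krausPairing z.2 z.1)) p (γ.prod γ) := by
        conv_lhs => rw [hγ, ← gaussianMatrix_prod_map_rotation v]
        have hN : Measurable fun z : Matrix (Fin n × Fin k) (Fin d) ℂ ×
            Matrix (Fin n × Fin k) (Fin d) ℂ => schattenNorm q (superOp z.1 - superOp z.2) :=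
          (measurable_schattenNorm q).comp hcontd.measurable
        rw [eLpNorm_map_measure hN.aestronglyMeasurable hrot.measurable.aemeasurable]
        simp only [Function.comp_def, superOp_rotation]
        rfl
    _ ≤ eLpNorm ((fun z : Matrix (Fin n × Fin k) (Fin d) ℂ × Matrix (Fin n × Fin k) (Fin d) ℂ =>
          schattenNorm q (krausPairing z.1 z.2)) +
          fun z => schattenNorm q (krausPairing z.2 z.1)) p (γ.prod γ) := by
        refine eLpNorm_mono_real fun z => ?_
        rw [Real.norm_of_nonneg (schattenNorm_nonneg q _)]
        exact schattenNorm_add_le q _ _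
    _ ≤ eLpNorm (fun z : Matrix (Fin n × Fin k) (Fin d) ℂ × Matrix (Fin n × Fin k) (Fin d) ℂ =>
          schattenNorm q (krausPairing z.1 z.2)) p (γ.prod γ) +
        eLpNorm (fun z : Matrix (Fin n × Fin k) (Fin d) ℂ × Matrix (Fin n × Fin k) (Fin d) ℂ =>
          schattenNorm q (krausPairing z.2 z.1)) p (γ.prod γ) :=
        eLpNorm_add_le hF.aestronglyMeasurable (hF.comp measurable_swap).aestronglyMeasurable hp
    _ = _ := by
        have hswap : eLpNorm (fun z : Matrix (Fin n × Fin k) (Fin d) ℂ ×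
            Matrix (Fin n × Fin k) (Fin d) ℂ => schattenNorm q (krausPairing z.2 z.1)) p
            (γ.prod γ) = eLpNorm (fun z : Matrix (Fin n × Fin k) (Fin d) ℂ ×
            Matrix (Fin n × Fin k) (Fin d) ℂ => schattenNorm q (krausPairing z.1 z.2)) p
            (γ.prod γ) := by
          conv_rhs => rw [← Measure.prod_swap]
          rw [eLpNorm_map_measure hF.aestronglyMeasurable measurable_swap.aemeasurable]
          rfl
        rw [hswap, two_mul]

theorem memLp_krausPairing_gaussianMatrix (v : ℝ≥0) {p : ℝ≥0∞} (hp' : p ≠ ∞)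
    (q : ℝ≥0∞) [Fact (1 ≤ q)] :
    MemLp (fun z : Matrix (Fin n × Fin k) (Fin d) ℂ × Matrix (Fin n × Fin k) (Fin d) ℂ =>
        schattenNorm q (krausPairing z.1 z.2)) p
        ((gaussianMatrix (Fin n × Fin k) (Fin d) v).prod
          (gaussianMatrix (Fin n × Fin k) (Fin d) v)) := by
  refine memLp_schattenNorm q fun a b => ?_
  simp only [krausPairing_apply]
  refine memLp_finsetSum _ fun i _ => ?_
  -- A product of two variables in `L^(2p)` is in `L^p`.
  have htriple : ENNReal.HolderTriple (2 * p) (2 * p) p := ⟨by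
    rw [ENNReal.mul_inv (by simp) (by simp), ← add_mul, ENNReal.inv_two_add_inv_two, one_mul]⟩
  have h2p : 2 * p ≠ ∞ := ENNReal.mul_ne_top (by simp) hp'
  exact MemLp.mul (p := 2 * p) (q := 2 * p)
    ((memLp_entry_gaussianMatrix v h2p (a.2, i) b.2).star.comp_snd _)
    ((memLp_entry_gaussianMatrix v h2p (a.1, i) b.1).comp_fst _)

/-- The blocks `Y i` and the conjugates of the blocks `Z i` assemble to two independent Gaussian
matrices. The conjugation compensates for the one in `krausPairing`. -/
theorem hasLaw_gaussian_blocks {Ω' : Type*} [MeasurableSpace Ω'] {μ' : Measure Ω'}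
    [IsProbabilityMeasure μ'] {Y Z : Fin k → Ω' → Matrix (Fin n) (Fin d) ℂ} {v : ℝ≥0}
    (hY : ∀ i, HasLaw (Y i) (ginibre n d v) μ') (hZ : ∀ i, HasLaw (Z i) (ginibre n d v) μ')
    (hindep : iIndepFun (Sum.elim Y Z) μ') :
    HasLaw (fun ω => ((Matrix.of fun (x : Fin n × Fin k) j => Y x.2 ω x.1 j),
      (Matrix.of fun (x : Fin n × Fin k) j => conj (Z x.2 ω x.1 j))))
      ((gaussianMatrix (Fin n × Fin k) (Fin d) v).prod
        (gaussianMatrix (Fin n × Fin k) (Fin d) v)) μ' := by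
  have hW : ∀ s, HasLaw (Sum.elim Y Z s) (gaussianMatrix (Fin n) (Fin d) v) μ' := by
    rintro (i | i)
    · exact hY i
    · exact hZ i
  have hWm : AEMeasurable (fun ω s => Sum.elim Y Z s ω) μ' :=
    aemeasurable_pi_lambda _ fun s => (hW s).aemeasurable
  have hmap : μ'.map (fun ω s => Sum.elim Y Z s ω) =
      Measure.pi fun _ => gaussianMatrix (Fin n) (Fin d) v := by
    rw [(iIndepFun_iff_map_fun_eq_pi_map fun s => (hW s).aemeasurable).1 hindep]
    congr 1
    funext s
    exact (hW s).map_eq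
  let S : (Fin k → Matrix (Fin n) (Fin d) ℂ) → Matrix (Fin n × Fin k) (Fin d) ℂ :=
    fun W => Matrix.of fun x j => W x.2 x.1 j
  have hS : Measurable S := measurable_matrix fun i j =>
    (measurable_entry i.1 j).comp (measurable_pi_apply i.2)
  have hC : Measurable fun G : Matrix (Fin n × Fin k) (Fin d) ℂ => G.map conj :=
    measurable_matrix fun i j => measurable_conj.comp (measurable_entry i j)
  let e := MeasurableEquiv.sumPiEquivProdPi fun _ : Fin k ⊕ Fin k => Matrix (Fin n) (Fin d) ℂ
  have he : Measure.map e (Measure.pi fun _ => gaussianMatrix (Fin n) (Fin d) v) =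
      (Measure.pi fun _ => gaussianMatrix (Fin n) (Fin d) v).prod
        (Measure.pi fun _ => gaussianMatrix (Fin n) (Fin d) v) :=
    (measurePreserving_sumPiEquivProdPi fun _ => gaussianMatrix (Fin n) (Fin d) v).map_eq
  have hCS : Measurable fun W => (S W).map conj := hC.comp hS
  have hΨ : Measurable (Prod.map S fun W => (S W).map conj) := hS.prodMap hCS
  have h2 : (Measure.pi fun _ : Fin k => gaussianMatrix (Fin n) (Fin d) v).map S =
      gaussianMatrix (Fin n × Fin k) (Fin d) v := pi_gaussianMatrix_map v
  have h3 : (Measure.pi fun _ : Fin k => gaussianMatrix (Fin n) (Fin d) v).map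
      (fun W => (S W).map conj) = gaussianMatrix (Fin n × Fin k) (Fin d) v :=
    calc _ = (Measure.map S (Measure.pi fun _ => gaussianMatrix (Fin n) (Fin d) v)).map
          fun G => G.map conj := (Measure.map_map hC hS).symm
      _ = _ := by rw [h2, gaussianMatrix_map_conj]
  refine ⟨(hΨ.comp e.measurable).comp_aemeasurable hWm, ?_⟩
  have h1 : μ'.map ((Prod.map S fun W => (S W).map conj) ∘ e ∘ fun ω s => Sum.elim Y Z s ω) =
      (gaussianMatrix (Fin n × Fin k) (Fin d) v).prod
        (gaussianMatrix (Fin n × Fin k) (Fin d) v) := by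
    rw [← AEMeasurable.map_map_of_aemeasurable hΨ.aemeasurable
      (e.measurable.comp_aemeasurable hWm), ← AEMeasurable.map_map_of_aemeasurable
      e.measurable.aemeasurable hWm, hmap, he, ← Measure.map_prod_map _ _ hS hCS, h2, h3]
  exact h1

theorem integral_rpow_eq_toReal_eLpNorm_rpow {Ω : Type*} [MeasurableSpace Ω] {μ : Measure Ω}
    {p : ℝ} (hp : 1 ≤ p) {f : Ω → ℝ} (hf0 : ∀ ω, 0 ≤ f ω) (hf : MemLp f (ENNReal.ofReal p) μ) :
    Integrable (fun ω => f ω ^ p) μ ∧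
      ∫ ω, f ω ^ p ∂μ = (eLpNorm f (ENNReal.ofReal p) μ).toReal ^ p := by
  have hp0 : ENNReal.ofReal p ≠ 0 := by simp; linarith
  have hpr : (ENNReal.ofReal p).toReal = p := ENNReal.toReal_ofReal (by linarith)
  have hi := hf.integrable_norm_rpow hp0 ENNReal.ofReal_ne_top
  have h := hf.eLpNorm_eq_integral_rpow_norm hp0 ENNReal.ofReal_ne_top
  rw [hpr] at hi h
  simp only [Real.norm_of_nonneg (hf0 _)] at hi h
  refine ⟨hi, ?_⟩
  have hint : 0 ≤ ∫ ω, f ω ^ p ∂μ := integral_nonneg fun ω => Real.rpow_nonneg (hf0 ω) p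
  rw [h, ENNReal.toReal_ofReal (Real.rpow_nonneg hint _), ← Real.rpow_mul hint,
    inv_mul_cancel₀ (by linarith), Real.rpow_one]

end Chain

end

theorem proposition5p2 {n d k : ℕ} (hd : 2 ≤ d) (hdnk : d ≤ n * k)
    {Ω : Type*} [MeasurableSpace Ω] (μ : Measure Ω) [IsProbabilityMeasure μ]
    (V : Ω → Matrix (Fin n × Fin k) (Fin d) ℂ) (hVm : AEMeasurable V μ)
    (hV : IsHaarIsometryLaw (μ.map V))
    {Ω' : Type*} [MeasurableSpace Ω'] (μ' : Measure Ω') [IsProbabilityMeasure μ']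
    (Y Z : Fin k → Ω' → Matrix (Fin n) (Fin d) ℂ)
    (hY : ∀ i, HasLaw (Y i) (ginibre n d ((n * k : ℕ) : ℝ≥0)⁻¹) μ')
    (hZ : ∀ i, HasLaw (Z i) (ginibre n d ((n * k : ℕ) : ℝ≥0)⁻¹) μ')
    (hindep : iIndepFun (Sum.elim Y Z) μ')
    (p : ℝ) (hp : 1 ≤ p) (q : ℝ≥0∞) (hq : 1 ≤ q) :
    Integrable (fun ω => schattenNorm q (superOp (V ω) * (1 - maxEnt d)) ^ p) μ ∧
    Integrable (fun ω => schattenNorm q (∑ i, Y i ω ⊗ₖ Z i ω) ^ p) μ' ∧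
    ∫ ω, schattenNorm q (superOp (V ω) * (1 - maxEnt d)) ^ p ∂μ ≤
      (2 / chi (n * k) d) ^ p *
        ∫ ω, schattenNorm q (∑ i, Y i ω ⊗ₖ Z i ω) ^ p ∂μ' := by
  have : Fact (1 ≤ q) := ⟨hq⟩
  have hnk : n * k ≠ 0 := by omega
  have hχ : 0 < chi (n * k) d := chi_pos hd hnk
  set P : ℝ≥0∞ := ENNReal.ofReal p with hP
  have hP1 : 1 ≤ P := by rw [hP, ← ENNReal.ofReal_one]; exact ENNReal.ofReal_le_ofReal hp
  have hPtop : P ≠ ∞ := ENNReal.ofReal_ne_top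
  set v : ℝ≥0 := ((n * k : ℕ) : ℝ≥0)⁻¹ with hv
  have hlaw := hasLaw_gaussian_blocks hY hZ hindep
  have hpair : ∀ ω, schattenNorm q (∑ i, Y i ω ⊗ₖ Z i ω) =
      schattenNorm q (krausPairing (Matrix.of fun (x : Fin n × Fin k) j => Y x.2 ω x.1 j)
        (Matrix.of fun (x : Fin n × Fin k) j => conj (Z x.2 ω x.1 j))) := by
    intro ω
    congr 1
    ext a b
    simp [krausPairing_apply, Matrix.sum_apply]
  have hF : Measurable fun z : Matrix (Fin n × Fin k) (Fin d) ℂ ×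
      Matrix (Fin n × Fin k) (Fin d) ℂ => schattenNorm q (krausPairing z.1 z.2) :=
    (measurable_schattenNorm q).comp continuous_krausPairing.measurable
  have hcont : Continuous fun V : Matrix (Fin n × Fin k) (Fin d) ℂ =>
      superOp V * (1 - maxEnt d) := continuous_superOp.matrix_mul continuous_const
  have hN : Measurable fun V : Matrix (Fin n × Fin k) (Fin d) ℂ =>
    schattenNorm q (superOp V * (1 - maxEnt d)) := (measurable_schattenNorm q).comp hcont.measurable
  have hYZ : MemLp (fun ω => schattenNorm q (∑ i, Y i ω ⊗ₖ Z i ω)) P μ' := by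
    have h := memLp_krausPairing_gaussianMatrix (n := n) (k := k) (d := d) v hPtop q
    rw [← hlaw.map_eq, memLp_map_measure_iff hF.aestronglyMeasurable hlaw.aemeasurable] at h
    simp only [hpair]
    exact h
  have hmain : ENNReal.ofReal (chi (n * k) d) *
      eLpNorm (fun ω => schattenNorm q (superOp (V ω) * (1 - maxEnt d))) P μ ≤
      2 * eLpNorm (fun ω => schattenNorm q (∑ i, Y i ω ⊗ₖ Z i ω)) P μ' := by
    have h1 := (eLpNorm_superOp_isometry_le hd hnk hV hP1 hPtop q).trans
      (eLpNorm_superOp_gaussianMatrix_le (by omega) v hP1 hPtop q)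
    rw [← hlaw.map_eq, eLpNorm_map_measure hF.aestronglyMeasurable hlaw.aemeasurable,
      eLpNorm_map_measure hN.aestronglyMeasurable hVm] at h1
    simp only [hpair]
    exact h1
  -- Finiteness on the left comes from the inequality itself, since `0 < χ`.
  have hVp : MemLp (fun ω => schattenNorm q (superOp (V ω) * (1 - maxEnt d))) P μ := by
    refine ⟨(hN.comp_aemeasurable hVm).aestronglyMeasurable, lt_top_iff_ne_top.2 fun htop => ?_⟩
    rw [htop, ENNReal.mul_top (by simpa using hχ), top_le_iff] at hmain
    exact ENNReal.mul_ne_top (by simp) hYZ.2.ne hmain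
  obtain ⟨hi1, he1⟩ := integral_rpow_eq_toReal_eLpNorm_rpow hp
    (fun ω => schattenNorm_nonneg q (superOp (V ω) * (1 - maxEnt d))) hVp
  obtain ⟨hi2, he2⟩ := integral_rpow_eq_toReal_eLpNorm_rpow hp
    (fun ω => schattenNorm_nonneg q (∑ i, Y i ω ⊗ₖ Z i ω)) hYZ
  refine ⟨hi1, hi2, ?_⟩
  rw [he1, he2, ← Real.mul_rpow (by positivity) ENNReal.toReal_nonneg]
  refine Real.rpow_le_rpow ENNReal.toReal_nonneg ?_ (by linarith)
  have h := ENNReal.toReal_mono (ENNReal.mul_ne_top (by simp) hYZ.2.ne) hmain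
  rw [ENNReal.toReal_mul, ENNReal.toReal_mul, ENNReal.toReal_ofReal hχ.le,
    ENNReal.toReal_ofNat] at h
  rw [div_mul_eq_mul_div, le_div_iff₀ hχ, mul_comm]
  exact h
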